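/- A numerical semigroup is a submonoid $S$ of $(\mathbb N,+)$ (with $0\in\mathbb N$) such that $\mathbb N\setminus S$ is finite. Put $S^*=S\setminus\{0\}$, and let $m=\min S^*$ be the multiplicity of $S$, $c$ the conductor, i.e. the least $c\in\mathbb N$ such that every integer $n\ge c$ belongs to $S$, $e$ the embedding dimension, i.e. the least cardinality of a generating set of $S$, and $L=\{s\in S\mid s<c\}$ the left part of $S$. Let $P$ be the set of primitive elements of $S$, i.e. of those elements of $S^*$ that are not a sum of two elements of $S^*$, and let $D=S^*\setminus P$. Let $q=\lceil c/m\rceil$, $\rho=qm-c$ and $D_q=D\cap[qm-\rho,(q+1)m-\rho[\,=D\cap[c,c+m[$. Define $$W(S)=e|L|-c,\qquad W_0(S)=|P\cap L|\,|L|-q|D_q|+\rho .$$ **Theorem.** (1) Let $S$ be a numerical semigroup such that $|L|\le 12$. Then $W_0(S)\ge 0$. In particular, $S$ satisfies Wilf's conjecture, i.e. $e|L|\ge c$. (2) For every numerical semigroup $S$ one has $W(S)\ge W_0(S)$. (3) The bound $12$ in (1) is best possible for the inequality $W_0(S)\ge 0$: the set $S=\langle 14,22,23\rangle\cup\{n\in\mathbb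 N\mid n\ge 56\}$ is a numerical semigroup with $|L|=13$ and $W_0(S)=-1$. -/

import Mathlib

namespace NumSemigroup

/-- A numerical semigroup: a submonoid of `(ℕ, +)` with finite complement. -/
def IsNumericalSemigroup (S : AddSubmonoid ℕ) : Prop :=
  ((S : Set ℕ)ᶜ).Finite

/-- The set `S* = S \ {0}`. -/
def star (S : AddSubmonoid ℕ) : Set ℕ := (S : Set ℕ) \ {0}

/-- The multiplicity `m = min S*`. -/
noncomputable def multiplicity (S : AddSubmonoid ℕ) : ℕ := sInf (star S)

/-- The conductor: the least `c ∈ ℕ` such that `[c, ∞[ ⊆ S`. -/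
noncomputable def conductor (S : AddSubmonoid ℕ) : ℕ :=
  sInf {c : ℕ | Set.Ici c ⊆ (S : Set ℕ)}

/-- The embedding dimension: the least cardinality of a finite generating set of `S`. -/
noncomputable def embDim (S : AddSubmonoid ℕ) : ℕ :=
  sInf {n : ℕ | ∃ T : Finset ℕ, T.card = n ∧ AddSubmonoid.closure (T : Set ℕ) = S}

/-- The left part `L = {s ∈ S | s < c}`. -/
def leftPart (S : AddSubmonoid ℕ) : Set ℕ := {s | s ∈ S ∧ s < conductor S}

/-- The primitive elements of `S`: those elements of `S*` which are not a sum of two elements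
of `S*` (such summands are automatically smaller). -/
def primitives (S : AddSubmonoid ℕ) : Set ℕ :=
  {x | x ∈ star S ∧ ¬ ∃ a ∈ star S, ∃ b ∈ star S, x = a + b}

/-- The decomposable elements `D = S* \ P`. -/
def decomposables (S : AddSubmonoid ℕ) : Set ℕ := star S \ primitives S

/-- The depth `q = ⌈c / m⌉`. -/
noncomputable def depth (S : AddSubmonoid ℕ) : ℕ :=
  ⌈(conductor S : ℚ) / (multiplicity S : ℚ)⌉₊

/-- The offset `ρ = q m - c`. -/
noncomputable def offset (S : AddSubmonoid ℕ) : ℤ :=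
  (depth S : ℤ) * (multiplicity S : ℤ) - (conductor S : ℤ)

/-- The integer interval `I_j = [j m - ρ, (j + 1) m - ρ[`. -/
def levelInterval (S : AddSubmonoid ℕ) (j : ℤ) : Set ℤ :=
  Set.Ico (j * (multiplicity S : ℤ) - offset S) ((j + 1) * (multiplicity S : ℤ) - offset S)

/-- `D_j = D ∩ I_j`. -/
def decomposablesAt (S : AddSubmonoid ℕ) (j : ℤ) : Set ℕ :=
  {x | x ∈ decomposables S ∧ (x : ℤ) ∈ levelInterval S j}

/-- `W(S) = e |L| - c`. -/
noncomputable def W (S : AddSubmonoid ℕ) : ℤ :=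
  (embDim S : ℤ) * ((leftPart S).ncard : ℤ) - (conductor S : ℤ)

/-- `W₀(S) = |P ∩ L| |L| - q |D_q| + ρ`. -/
noncomputable def W₀ (S : AddSubmonoid ℕ) : ℤ :=
  ((primitives S ∩ leftPart S).ncard : ℤ) * ((leftPart S).ncard : ℤ)
    - (depth S : ℤ) * ((decomposablesAt S (depth S : ℤ)).ncard : ℤ) + offset S

/-- `S` satisfies Wilf's conjecture: `e |L| ≥ c`. -/
def SatisfiesWilf (S : AddSubmonoid ℕ) : Prop :=
  embDim S * (leftPart S).ncard ≥ conductor S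

end NumSemigroup

/-!
The inequality `W₀ ≥ 0` is reduced to a statement about the Apéry set with respect to the
multiplicity `m`. Write `c` for the conductor, `q` for the depth, `ρ = q m - c`. Let `P` be the set
of primitive elements below `c` other than `m`, let `D` be the set of decomposable Apéry elements,
and for an Apéry element `x` let `k(x) = ⌈(c - x) / m⌉`, the number of left elements in the
progression `x + m ℕ` (`tailCount`). Then the left part has `q + w` elements, where
`w = ∑ k(x)` over `P ∪ D`, and `[c, c + m[` contains at most `1 + #P + #D` decomposable elements.
So `W₀ ≥ 0` follows from `q #D ≤ (#P + 1) w + ρ`, which has to be shown for `q + w ≤ 12`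
(`AperySystem.bound`).

The basic relation is `k(a) + k(b) ≥ q + k(x)` for `x = a + b` in `D`. It may fail by one, but only
for `x` in `ρ` prescribed residue classes, hence for at most `ρ` elements `x`, since Apéry elements
are pairwise incongruent. Adding it up over the elements of `D` that are sums of two elements of
`P`, and noting that each `p ∈ P` is used at most `#P + 1` times, gives the bound for these pair
sums (`AperySystem.card_pairSums_mul_le`); the term `ρ` absorbs the defects. It remains to pay for
the long sums, the elements of `D` that need at least three summands, out of the weight of `D`
(`AperySystem.bound_of_longSums`).

Long sums are expensive: all their partial sums are Apéry elements below `c` and contribute to `w`.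
With `q + w ≤ 12` there are none for `q ≤ 2` and for `q ≥ 7`, and for `q = 5, 6` they are multiples
of a single element of `P`. For `q = 3, 4` they are sums of three elements of `P`, apart from one
exceptional shape, and are counted against the set of pair sums below `c` dividing them
(`card_le_of_card_le_two`, `two_mul_card_le`, `card_le_four`).

The inequality `W₀ ≤ W` holds because a generating set contains all primitive elements, including
those in `[c, c + m[`, and the left part contains the `q` multiples of `m` below `c`. The
example with thirteen left elements is a finite computation.
-/

namespace NumSemigroup

open Finset

/-! ### Tail counts and Apéry systems -/

/-- The number of elements of the progression `x, x + m, x + 2m, …` lying below `c`, that is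
`⌈(c - x) / m⌉`, and `0` if `c ≤ x`. -/
def tailCount (c m x : ℕ) : ℕ := (c - x + (m - 1)) / m

theorem tailCount_le_iff {c m : ℕ} (hm : 0 < m) (x j : ℕ) :
    tailCount c m x ≤ j ↔ c ≤ x + j * m := by
  rw [tailCount, Nat.div_le_iff_le_mul_add_pred hm, mul_comm m j]
  omega

theorem tailCount_pos_iff {c m : ℕ} (hm : 0 < m) (x : ℕ) : 1 ≤ tailCount c m x ↔ x < c := by
  have := tailCount_le_iff (c := c) hm x 0
  omega

theorem le_add_tailCount {c m : ℕ} (hm : 0 < m) (x : ℕ) : c ≤ x + tailCount c m x * m :=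
  (tailCount_le_iff hm x _).1 le_rfl

theorem add_tailCount_lt {c m : ℕ} (hm : 0 < m) {x : ℕ} (hx : x < c + m) :
    x + tailCount c m x * m < c + m := by
  rcases Nat.eq_zero_or_pos (tailCount c m x) with h | h
  · simpa [h] using hx
  · have h1 := (tailCount_le_iff (c := c) hm x (tailCount c m x - 1)).not.1 (by omega)
    obtain ⟨j, hj⟩ := Nat.exists_eq_add_of_le' h
    rw [hj] at h1 ⊢
    simp only [Nat.add_sub_cancel] at h1
    rw [add_mul]
    omega

/-- The combinatorial data extracted from a numerical semigroup with multiplicity `m`, conductor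
`c`, depth `q` and offset `ρ`: the set `P` stands for the primitive elements below `c` other
than `m`, and `D` for the decomposable elements of the Apéry set with respect to `m`. -/
structure AperySystem (m c q ρ : ℕ) (P D : Finset ℕ) : Prop where
  offset_lt : ρ < m
  conductor_add : c + ρ = q * m
  disj : Disjoint P D
  lt_of_mem : ∀ p ∈ P, m < p
  lt_conductor : ∀ p ∈ P, p < c
  lt_of_mem_dec : ∀ x ∈ D, x < c + m
  exists_add : ∀ x ∈ D, ∃ a ∈ P, ∃ b ∈ P ∪ D, x = a + b
  closed : ∀ a ∈ P ∪ D, ∀ b ∈ P ∪ D, ∀ z ∈ P ∪ D, a + b + z ∈ D → a + b ∈ D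
  mod_inj : ∀ x ∈ P ∪ D, ∀ y ∈ P ∪ D, x % m = y % m → x = y
  mod_ne : ∀ x ∈ P ∪ D, x % m ≠ 0

/-- The elements of `D` that are a sum of two elements of `P`. -/
def pairSums (P D : Finset ℕ) : Finset ℕ := {x ∈ D | ∃ a ∈ P, ∃ b ∈ P, x = a + b}

/-- The elements of `D` that are not a sum of two elements of `P`. -/
def longSums (P D : Finset ℕ) : Finset ℕ := {x ∈ D | ¬ ∃ a ∈ P, ∃ b ∈ P, x = a + b}

theorem card_pairSums_add_card_longSums (P D : Finset ℕ) :
    #(pairSums P D) + #(longSums P D) = #D :=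
  card_filter_add_card_filter_not _

theorem add_card_le_sum {s : Finset ℕ} {f : ℕ → ℕ} (hf : ∀ x ∈ s, 1 ≤ f x) {a : ℕ}
    (ha : a ∈ s) : f a + #s ≤ ∑ x ∈ s, f x + 1 := by
  rw [← add_sum_erase s f ha, ← card_erase_add_one ha]
  have : #(s.erase a) ≤ ∑ x ∈ s.erase a, f x := by
    simpa using card_nsmul_le_sum (s.erase a) f 1 fun x hx => hf x (mem_of_mem_erase hx)
  omega

theorem add_add_card_le_sum {s : Finset ℕ} {f : ℕ → ℕ} (hf : ∀ x ∈ s, 1 ≤ f x) {a b : ℕ}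
    (ha : a ∈ s) (hb : b ∈ s) (hab : a ≠ b) : f a + f b + #s ≤ ∑ x ∈ s, f x + 2 := by
  have := add_card_le_sum (fun x hx => hf x (mem_of_mem_erase hx))
    (mem_erase.2 ⟨hab.symm, hb⟩ : b ∈ s.erase a)
  rw [← add_sum_erase s f ha, ← card_erase_add_one ha]
  omega

theorem le_sum_pair {s : Finset ℕ} (f : ℕ → ℕ) {a b : ℕ}
    (ha : a ∈ s) (hb : b ∈ s) (hab : a ≠ b) : f a + f b ≤ ∑ x ∈ s, f x := by
  rw [← sum_pair hab]
  exact sum_le_sum_of_subset (by simp [insert_subset_iff, ha, hb])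

theorem le_sum_triple {s : Finset ℕ} (f : ℕ → ℕ) {a b c : ℕ} (ha : a ∈ s) (hb : b ∈ s)
    (hc : c ∈ s) (hab : a ≠ b) (hac : a ≠ c) (hbc : b ≠ c) :
    f a + f b + f c ≤ ∑ x ∈ s, f x := by
  rw [← add_sum_erase s f ha, add_assoc]
  gcongr
  exact le_sum_pair f (mem_erase.2 ⟨hab.symm, hb⟩) (mem_erase.2 ⟨hac.symm, hc⟩) hbc

namespace AperySystem

variable {m c q ρ : ℕ} {P D : Finset ℕ}

theorem mult_pos (h : AperySystem m c q ρ P D) : 0 < m := by have := h.offset_lt; omega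

theorem one_le_tailCount (h : AperySystem m c q ρ P D) {p : ℕ} (hp : p ∈ P) :
    1 ≤ tailCount c m p := (tailCount_pos_iff h.mult_pos p).2 (h.lt_conductor p hp)

theorem two_mul_lt (h : AperySystem m c q ρ P D) {x : ℕ} (hx : x ∈ D) : 2 * m < x := by
  induction x using Nat.strong_induction_on with
  | _ x ih =>
    obtain ⟨a, ha, b, hb, rfl⟩ := h.exists_add x hx
    have h1 := h.lt_of_mem a ha
    rcases mem_union.1 hb with hb | hb
    · have := h.lt_of_mem b hb; omega
    · have := ih b (by omega) hb; omega

theorem mult_lt (h : AperySystem m c q ρ P D) {x : ℕ} (hx : x ∈ P ∪ D) : m < x := by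
  rcases mem_union.1 hx with hx | hx
  · exact h.lt_of_mem x hx
  · have := h.two_mul_lt hx; omega

theorem lt_of_add_mem (h : AperySystem m c q ρ P D) {y z : ℕ} (hz : z ∈ P ∪ D)
    (hx : y + z ∈ D) : y < c := by
  have h1 := h.mult_lt hz
  have h2 := h.lt_of_mem_dec _ hx
  omega

theorem one_le_tailCount_of_add_mem (h : AperySystem m c q ρ P D) {y z : ℕ} (hz : z ∈ P ∪ D)
    (hx : y + z ∈ D) : 1 ≤ tailCount c m y :=
  (tailCount_pos_iff h.mult_pos y).2 (h.lt_of_add_mem hz hx)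

/-- If `x = a + b` then the tail counts of `a` and `b` add up to at least `q` plus that of `x`,
unless the least element of `x + m ℕ` that is at least `c` lies in `[c + m - ρ, c + m[`. -/
theorem le_add_tailCount_of_not_defect (h : AperySystem m c q ρ P D) {a b : ℕ}
    (hd : ¬ c + m ≤ a + b + tailCount c m (a + b) * m + ρ) :
    q + tailCount c m (a + b) ≤ tailCount c m a + tailCount c m b := by
  have h1 := le_add_tailCount (c := c) h.mult_pos a
  have h2 := le_add_tailCount (c := c) h.mult_pos b
  have h4 := h.conductor_add
  by_contra! hlt
  have h5 : (tailCount c m a + tailCount c m b + 1) * m ≤ (q + tailCount c m (a + b)) * m :=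
    Nat.mul_le_mul_right _ hlt
  simp only [add_mul, one_mul] at h5
  omega

/-- In general the inequality of `le_add_tailCount_of_not_defect` fails by at most one. -/
theorem le_add_tailCount_add_one (h : AperySystem m c q ρ P D) {a b : ℕ} (hx : a + b ∈ D) :
    q + tailCount c m (a + b) ≤ tailCount c m a + tailCount c m b + 1 := by
  have h1 := le_add_tailCount (c := c) h.mult_pos a
  have h2 := le_add_tailCount (c := c) h.mult_pos b
  have h3 := add_tailCount_lt h.mult_pos (h.lt_of_mem_dec _ hx)
  have h4 := h.conductor_add
  have h6 := h.offset_lt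
  by_contra! hlt
  have h5 : (tailCount c m a + tailCount c m b + 2) * m ≤ (q + tailCount c m (a + b)) * m :=
    Nat.mul_le_mul_right _ hlt
  simp only [add_mul] at h5
  omega

/-- The elements of `D` at which the inequality of `le_add_tailCount_of_not_defect` may fail.
They lie in `ρ` prescribed residue classes modulo `m`. -/
theorem card_defect_le (h : AperySystem m c q ρ P D) :
    #{x ∈ D | c + m ≤ x + tailCount c m x * m + ρ} ≤ ρ := by
  have hm := h.mult_pos
  have h0 := h.offset_lt
  have hcard : #(Ico (c + m - ρ) (c + m)) = ρ := by rw [Nat.card_Ico]; omega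
  rw [← hcard]
  refine card_le_card_of_injOn (fun x => x + tailCount c m x * m) (fun x hx => ?_)
    fun x hx y hy hxy => ?_
  · simp only [coe_filter, Set.mem_ofPred_eq] at hx
    have := add_tailCount_lt hm (h.lt_of_mem_dec x hx.1)
    simp only [coe_Ico, Set.mem_Ico]
    omega
  · simp only [coe_filter, Set.mem_ofPred_eq] at hx hy
    refine h.mod_inj x (mem_union_right _ hx.1) y (mem_union_right _ hy.1) ?_
    have := congrArg (· % m) hxy
    simpa using this

/-- Each `p ∈ P` occurs at most `#P + 1` times as a summand when every element of a set of sums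
of two elements of `P` is written as such a sum: `p + p` counts twice, and `p + a` once for each
other `a`. -/
theorem card_summand_le (E : Finset ℕ) (f g : ℕ → ℕ)
    (hf : ∀ x ∈ E, f x ∈ P) (hg : ∀ x ∈ E, g x ∈ P) (hfg : ∀ x ∈ E, x = f x + g x) (p : ℕ) :
    #{x ∈ E | f x = p} + #{x ∈ E | g x = p} ≤ #P + 1 := by
  rw [← card_union_add_card_inter, ← filter_or, ← filter_and]
  refine add_le_add ?_ ?_
  · refine card_le_card_of_injOn (fun x => x - p) (fun x hx => ?_) fun x hx y hy hxy => ?_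
    · simp only [coe_filter, Set.mem_ofPred_eq] at hx
      have h1 := hf x hx.1
      have h2 := hg x hx.1
      have h3 := hfg x hx.1
      rcases hx.2 with h4 | h4
      · have : x - p = g x := by omega
        simpa [this] using h2
      · have : x - p = f x := by omega
        simpa [this] using h1
    · simp only [coe_filter, Set.mem_ofPred_eq] at hx hy hxy
      have h3 := hfg x hx.1
      have h4 := hfg y hy.1
      omega
  · refine card_le_one.2 fun x hx y hy => ?_
    simp only [mem_filter] at hx hy
    have h3 := hfg x hx.1
    have h4 := hfg y hy.1
    omega

/-- The double count over pair sums: add up the inequality `q + k(a + b) ≤ k(a) + k(b)`, with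
`k` the tail count, over all pair sums. Each `k(p)` is used at most `#P + 1` times, and the
defects amount to at most `ρ`. -/
theorem card_pairSums_mul_le (h : AperySystem m c q ρ P D) :
    q * #(pairSums P D) + ∑ x ∈ pairSums P D, tailCount c m x ≤
      (#P + 1) * ∑ p ∈ P, tailCount c m p + ρ := by
  classical
  have hE : ∀ x ∈ pairSums P D, ∃ y : ℕ × ℕ, y.1 ∈ P ∧ y.2 ∈ P ∧ x = y.1 + y.2 := by
    intro x hx
    obtain ⟨a, ha, b, hb, hab⟩ := (mem_filter.1 hx).2
    exact ⟨(a, b), ha, hb, hab⟩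
  choose! y hy1 hy2 hy using hE
  have hED : ∀ x ∈ pairSums P D, x ∈ D := fun x hx => (mem_filter.1 hx).1
  have key : ∀ x ∈ pairSums P D, q + tailCount c m x ≤
      tailCount c m (y x).1 + tailCount c m (y x).2 +
        if c + m ≤ x + tailCount c m x * m + ρ then 1 else 0 := by
    intro x hx
    have hxD := hED x hx
    have hxy := hy x hx
    split_ifs with hd
    · rw [hxy] at hxD
      simpa only [← hxy] using h.le_add_tailCount_add_one hxD
    · rw [hxy] at hd
      simpa only [← hxy, add_zero] using h.le_add_tailCount_of_not_defect hd
  have hsum := sum_le_sum key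
  rw [sum_add_distrib, sum_add_distrib, sum_add_distrib, sum_const, smul_eq_mul, mul_comm,
    ← card_filter] at hsum
  have hdef : #{x ∈ pairSums P D | c + m ≤ x + tailCount c m x * m + ρ} ≤ ρ :=
    (card_le_card (filter_subset_filter _ (filter_subset _ _))).trans h.card_defect_le
  have hfib : ∀ f : ℕ → ℕ, (∀ x ∈ pairSums P D, f x ∈ P) →
      ∑ x ∈ pairSums P D, tailCount c m (f x) =
        ∑ p ∈ P, #{x ∈ pairSums P D | f x = p} * tailCount c m p := by
    intro f hf
    rw [← sum_fiberwise_of_maps_to hf]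
    refine sum_congr rfl fun p _ => ?_
    rw [sum_congr rfl fun x hx => by rw [(mem_filter.1 hx).2], sum_const, smul_eq_mul]
  rw [hfib (fun x => (y x).1) hy1, hfib (fun x => (y x).2) hy2, ← sum_add_distrib] at hsum
  have hdeg : ∑ p ∈ P, (#{x ∈ pairSums P D | (y x).1 = p} * tailCount c m p +
      #{x ∈ pairSums P D | (y x).2 = p} * tailCount c m p) ≤
      (#P + 1) * ∑ p ∈ P, tailCount c m p := by
    rw [mul_sum]
    refine sum_le_sum fun p _ => ?_
    rw [← add_mul]
    exact Nat.mul_le_mul_right _ (card_summand_le _ _ _ hy1 hy2 hy p)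
  omega

/-- A sufficient condition for the desired inequality, in terms of the long sums only. -/
theorem bound_of_longSums (h : AperySystem m c q ρ P D)
    (hU : q * #(longSums P D) ≤
      (#P + 1) * ∑ x ∈ D, tailCount c m x + ∑ x ∈ pairSums P D, tailCount c m x) :
    q * #D ≤ (#P + 1) * (∑ x ∈ P, tailCount c m x + ∑ x ∈ D, tailCount c m x) + ρ := by
  have h1 := h.card_pairSums_mul_le
  rw [← card_pairSums_add_card_longSums P D, mul_add, mul_add]
  omega

/-- There are at most `n (n + 1) / 2` sums of two elements from a set of `n` numbers. -/
theorem two_mul_card_pairSums_le (P D : Finset ℕ) :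
    2 * #(pairSums P D) ≤ #P * (#P + 1) := by
  have h1 : pairSums P D ⊆ P.sym2.image (Sym2.lift ⟨fun a b => a + b, add_comm⟩) := by
    intro x hx
    obtain ⟨a, ha, b, hb, rfl⟩ := (mem_filter.1 hx).2
    exact mem_image.2 ⟨s(a, b), by simp [ha, hb], rfl⟩
  have h2 := (card_le_card h1).trans card_image_le
  rw [card_sym2, Nat.choose_two_right] at h2
  have h3 : (#P + 1) * (#P + 1 - 1) = #P * (#P + 1) := by simp [mul_comm]
  omega

/-- The Apéry elements and `0` are pairwise incongruent modulo `m`. -/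
theorem card_add_card_lt (h : AperySystem m c q ρ P D) : #P + #D < m := by
  have hm := h.mult_pos
  have h1 : #(P ∪ D) ≤ #(Ico 1 m) := by
    refine card_le_card_of_injOn (· % m) (fun x hx => ?_) fun x hx y hy hxy =>
      h.mod_inj x hx y hy hxy
    have h2 := h.mod_ne x hx
    have h3 := Nat.mod_lt x hm
    simp only [coe_Ico, Set.mem_Ico]
    omega
  rw [card_union_of_disjoint h.disj, Nat.card_Ico] at h1
  omega

end AperySystem

/-! ### Counting long sums -/

theorem eq_of_card_le_two {Q : Finset ℕ} (hQ : #Q ≤ 2) {x y z : ℕ} (hx : x ∈ Q) (hy : y ∈ Q)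
    (hz : z ∈ Q) : x = y ∨ x = z ∨ y = z := by
  by_contra! hne
  have := card_le_card (show ({x, y, z} : Finset ℕ) ⊆ Q by simp [insert_subset_iff, hx, hy, hz])
  rw [card_eq_three.2 ⟨x, y, z, hne.1, hne.2.1, hne.2.2, rfl⟩] at this
  omega

/-- A set of triple sums has at most as many elements as the set `Q` of the pair sums that divide
them, provided that `#Q ≤ 2`: by the pigeonhole principle a triple sum has the form `a + a + b`,
and it can be sent to `a + b`. -/
theorem card_le_of_card_le_two {P Q U : Finset ℕ}
    (hU : ∀ x ∈ U, ∃ a ∈ P, ∃ b ∈ P, ∃ z ∈ P, x = a + b + z)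
    (hcl : ∀ a ∈ P, ∀ b ∈ P, ∀ z ∈ P, a + b + z ∈ U → a + b ∈ Q) (hQ : #Q ≤ 2) : #U ≤ #Q := by
  have hform : ∀ x ∈ U, ∃ y : ℕ × ℕ, y.1 ∈ P ∧ y.2 ∈ P ∧ x = y.1 + y.1 + y.2 := by
    intro x hx
    obtain ⟨a, ha, b, hb, z, hz, rfl⟩ := hU x hx
    have h1 := hcl a ha b hb z hz hx
    have h2 := hcl a ha z hz b hb (by rwa [add_right_comm])
    have h3 := hcl b hb z hz a ha (by rwa [show b + z + a = a + b + z by ring])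
    rcases eq_of_card_le_two hQ h1 h2 h3 with h4 | h4 | h4
    · exact ⟨(b, a), hb, ha, by dsimp only; omega⟩
    · exact ⟨(a, b), ha, hb, by dsimp only; omega⟩
    · exact ⟨(a, z), ha, hz, by dsimp only; omega⟩
  choose! y hy1 hy2 hy using hform
  refine card_le_card_of_injOn (fun x => (y x).1 + (y x).2) (fun x hx => ?_)
    fun x hx x' hx' hxx => ?_
  · have hx2 := hx
    rw [mem_coe, hy x hx, add_right_comm] at hx2
    exact hcl _ (hy1 x hx) _ (hy2 x hx) _ (hy1 x hx) hx2
  · rw [mem_coe] at hx hx'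
    obtain ⟨ha, hb, hab⟩ := And.intro (hy1 x hx) (And.intro (hy2 x hx) (hy x hx))
    obtain ⟨ha', hb', hab'⟩ := And.intro (hy1 x' hx') (And.intro (hy2 x' hx') (hy x' hx'))
    dsimp only at hxx
    generalize (y x).1 = a, (y x).2 = b, (y x').1 = a', (y x').2 = b' at *
    subst hab hab'
    by_contra hne
    have h1 := hcl a ha a ha b hb hx
    have h2 := hcl a' ha' a' ha' b' hb' hx'
    have h3 := hcl a ha b hb a ha (by rwa [add_right_comm])
    have h4 : a + a' ∈ Q := by
      rcases eq_of_card_le_two hQ h1 h2 h3 with h4 | h4 | h4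
      · omega
      · exact hcl a ha a' ha' a ha (by rwa [show a + a' + a = a' + a' + b' by omega])
      · exact hcl a ha a' ha' a' ha' (by rwa [show a + a' + a' = a + a + b by omega])
    rcases eq_of_card_le_two hQ h1 h2 h4 with h5 | h5 | h5 <;> omega

/-- A set `U` of triple sums satisfies `2 #U ≤ (#P + 1) #Q`, where `Q` contains the pair sums
that divide them: a triple sum not of the form `a + a + a` can be written in at least two ways as
an element of `Q` plus an element of `P`, and `a + a + a` corresponds to `a + a ∈ Q`. -/
theorem two_mul_card_le {P Q U : Finset ℕ}
    (hU : ∀ x ∈ U, ∃ a ∈ P, ∃ b ∈ P, ∃ z ∈ P, x = a + b + z)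
    (hcl : ∀ a ∈ P, ∀ b ∈ P, ∀ z ∈ P, a + b + z ∈ U → a + b ∈ Q) :
    2 * #U ≤ (#P + 1) * #Q := by
  classical
  have h1 : ∀ x ∈ U, 2 ≤ #{y ∈ Q ×ˢ P | y.1 + y.2 = x} +
      if ∃ a ∈ P, x = a + a + a then 1 else 0 := by
    intro x hx
    obtain ⟨a, ha, b, hb, z, hz, rfl⟩ := hU x hx
    have hab := hcl a ha b hb z hz hx
    have haz := hcl a ha z hz b hb (by rwa [add_right_comm])
    have hbz := hcl b hb z hz a ha (by rwa [show b + z + a = a + b + z by ring])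
    have two : ∀ y ∈ Q, ∀ p ∈ P, ∀ y' ∈ Q, ∀ p' ∈ P, y + p = a + b + z → y' + p' = a + b + z →
        p ≠ p' → 2 ≤ #{y ∈ Q ×ˢ P | y.1 + y.2 = a + b + z} := by
      intro y hy p hp y' hy' p' hp' e e' hne
      rw [← card_pair (show (y, p) ≠ (y', p') from fun e => hne (Prod.ext_iff.1 e).2)]
      exact card_le_card (by simp [insert_subset_iff, hy, hp, hy', hp', e, e'])
    rcases eq_or_ne a b with rfl | hne
    · rcases eq_or_ne a z with rfl | hne
      · have : 1 ≤ #{y ∈ Q ×ˢ P | y.1 + y.2 = a + a + a} :=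
          card_pos.2 ⟨(a + a, a), by simp [hab, ha]⟩
        rw [if_pos ⟨a, ha, rfl⟩]
        omega
      · exact (two _ hab z hz _ haz a ha rfl (by omega) hne.symm).trans (Nat.le_add_right _ _)
    · exact (two _ haz b hb _ hbz a ha (by omega) (by omega) hne.symm).trans
        (Nat.le_add_right _ _)
  have h2 := sum_le_sum h1
  rw [sum_const, smul_eq_mul, sum_add_distrib, ← card_filter] at h2
  have h3 : ∑ x ∈ U, #{y ∈ Q ×ˢ P | y.1 + y.2 = x} ≤ #Q * #P := by
    rw [← card_product]
    rw [sum_card_fiberwise_eq_card_filter]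
    exact card_filter_le _ _
  have h4 : #{x ∈ U | ∃ a ∈ P, x = a + a + a} ≤ #Q := by
    have h5 : ∀ x ∈ ({x ∈ U | ∃ a ∈ P, x = a + a + a} : Finset ℕ), x / 3 + x / 3 ∈ Q ∧
        x = x / 3 + x / 3 + x / 3 := by
      intro x hx
      obtain ⟨hx, a, ha, rfl⟩ := mem_filter.1 hx
      have h6 : (a + a + a) / 3 = a := by omega
      rw [h6]
      exact ⟨hcl a ha a ha a ha hx, rfl⟩
    refine card_le_card_of_injOn (fun x => x / 3 + x / 3) (fun x hx => (h5 x hx).1)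
      fun x hx y hy hxy => ?_
    have h6 := (h5 x hx).2
    have h7 := (h5 y hy).2
    dsimp only at hxy
    omega
  rw [add_mul, mul_comm (#P)]
  omega

/-- The elements of `P` that divide some triple sum in `U`. -/
def tripleSupport (P U : Finset ℕ) : Finset ℕ := {a ∈ P | ∃ b ∈ P, ∃ z ∈ P, a + b + z ∈ U}

/-- If the triple sums in `U` involve at most two elements `a` and `b` of `P`, there are at most
four of them, and `a + a + a` and `b + b + b` are among them if there are four. -/
theorem card_le_four {P U : Finset ℕ}
    (hU : ∀ x ∈ U, ∃ a ∈ P, ∃ b ∈ P, ∃ z ∈ P, x = a + b + z) (hV : #(tripleSupport P U) ≤ 2) :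
    #U ≤ 3 ∨ #U = 4 ∧ ∃ a ∈ P, ∃ b ∈ P, a ≠ b ∧ a + a + a ∈ U ∧ b + b + b ∈ U := by
  obtain ⟨a, b, hab⟩ : ∃ a b, tripleSupport P U ⊆ {a, b} := by
    rcases (tripleSupport P U).eq_empty_or_nonempty with h0 | ⟨a, ha⟩
    · exact ⟨0, 0, by simp [h0]⟩
    · have h1 := card_erase_add_one ha
      obtain ⟨b, hb⟩ := card_le_one_iff_subset_singleton.1
        (show #((tripleSupport P U).erase a) ≤ 1 by omega)
      exact ⟨a, b, subset_insert_iff.2 hb⟩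
  have hsub : U ⊆ {a + a + a, a + a + b, a + b + b, b + b + b} := by
    intro x hx
    obtain ⟨x1, h1, x2, h2, x3, h3, rfl⟩ := hU x hx
    have e1 := hab (mem_filter.2 ⟨h1, x2, h2, x3, h3, hx⟩)
    have e2 := hab (mem_filter.2 ⟨h2, x1, h1, x3, h3, by rwa [add_comm x2 x1]⟩)
    have e3 := hab (mem_filter.2 ⟨h3, x1, h1, x2, h2,
      by rwa [show x3 + x1 + x2 = x1 + x2 + x3 by ring]⟩)
    simp only [mem_insert, mem_singleton] at e1 e2 e3 ⊢
    omega
  by_cases h3 : #U ≤ 3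
  · exact Or.inl h3
  have h4 : #({a + a + a, a + a + b, a + b + b, b + b + b} : Finset ℕ) ≤ 4 := Finset.card_le_four
  have heq := eq_of_subset_of_card_le hsub (by omega)
  have hab' : a ≠ b := by
    rintro rfl
    have : #U ≤ 1 := by simpa using card_le_card hsub
    omega
  refine Or.inr ⟨by have := card_le_card hsub; omega, ?_⟩
  have ha3 : a + a + a ∈ U := by rw [heq]; simp
  have hb3 : b + b + b ∈ U := by rw [heq]; simp
  -- a triple with entries in `{a, b}` and sum `a + a + a` or `b + b + b` is constant
  have key : ∀ p ∈ ({a, b} : Finset ℕ), p + p + p ∈ U → p ∈ P := by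
    intro p hp hpU
    obtain ⟨x1, h1, x2, h2, x3, h3, e⟩ := hU _ hpU
    rw [e] at hpU
    have e1 := hab (mem_filter.2 ⟨h1, x2, h2, x3, h3, hpU⟩)
    have e2 := hab (mem_filter.2 ⟨h2, x1, h1, x3, h3, by rwa [add_comm x2 x1]⟩)
    have e3 := hab (mem_filter.2 ⟨h3, x1, h1, x2, h2,
      by rwa [show x3 + x1 + x2 = x1 + x2 + x3 by ring]⟩)
    simp only [mem_insert, mem_singleton] at hp e1 e2 e3
    have : x1 = p := by omega
    exact this ▸ h1
  exact ⟨a, key a (by simp) ha3, b, key b (by simp) hb3, hab', ha3, hb3⟩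

namespace AperySystem

variable {m c q ρ : ℕ} {P D : Finset ℕ}

theorem longSums_subset (P D : Finset ℕ) : longSums P D ⊆ D := filter_subset _ _

theorem exists_of_mem_longSums (h : AperySystem m c q ρ P D) {x : ℕ} (hx : x ∈ longSums P D) :
    ∃ a ∈ P, ∃ b ∈ P, ∃ z ∈ P ∪ D, x = a + b + z := by
  obtain ⟨hxD, hx2⟩ := mem_filter.1 hx
  obtain ⟨a, ha, y, hy, rfl⟩ := h.exists_add x hxD
  rcases mem_union.1 hy with hy | hy
  · exact absurd ⟨a, ha, y, hy, rfl⟩ hx2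
  · obtain ⟨b, hb, z, hz, rfl⟩ := h.exists_add y hy
    exact ⟨a, ha, b, hb, z, hz, by ring⟩

/-- The pair sums below the conductor. -/
def lowPairs (c : ℕ) (P D : Finset ℕ) : Finset ℕ := {x ∈ pairSums P D | x < c}

theorem card_lowPairs_le (h : AperySystem m c q ρ P D) :
    #(lowPairs c P D) ≤ ∑ x ∈ pairSums P D, tailCount c m x := by
  calc #(lowPairs c P D) ≤ ∑ x ∈ lowPairs c P D, tailCount c m x := by
        simpa using card_nsmul_le_sum (lowPairs c P D) (tailCount c m) 1 fun x hx =>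
          (tailCount_pos_iff h.mult_pos x).2 (mem_filter.1 hx).2
    _ ≤ _ := sum_le_sum_of_subset (filter_subset _ _)

theorem sum_pairSums_le (P D : Finset ℕ) (f : ℕ → ℕ) :
    ∑ x ∈ pairSums P D, f x ≤ ∑ x ∈ D, f x := sum_le_sum_of_subset (filter_subset _ _)

theorem tailCount_le_sum_pairSums {a b : ℕ} (ha : a ∈ P) (hb : b ∈ P) (hab : a + b ∈ D) :
    tailCount c m (a + b) ≤ ∑ x ∈ pairSums P D, tailCount c m x :=
  single_le_sum (f := tailCount c m) (fun _ _ => Nat.zero_le _)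
    (mem_filter.2 ⟨hab, a, ha, b, hb, rfl⟩ : a + b ∈ pairSums P D)

theorem add_mem_lowPairs (h : AperySystem m c q ρ P D) {a b z : ℕ} (ha : a ∈ P) (hb : b ∈ P)
    (hz : z ∈ P ∪ D) (hx : a + b + z ∈ D) : a + b ∈ lowPairs c P D :=
  mem_filter.2 ⟨mem_filter.2 ⟨h.closed a (mem_union_left _ ha) b (mem_union_left _ hb) z hz hx,
    a, ha, b, hb, rfl⟩, h.lt_of_add_mem hz hx⟩

theorem closed' (h : AperySystem m c q ρ P D) {a b z : ℕ} (ha : a ∈ P ∪ D) (hb : b ∈ P ∪ D)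
    (hz : z ∈ P ∪ D) (hx : a + b + z ∈ D) : b + z ∈ D :=
  h.closed b hb z hz a ha (by rwa [show b + z + a = a + b + z by ring])

/-- Two expressions `p + y` and `p' + y'` of elements of `D` with `p ≠ p'` and `y ≠ y'` consume a
total weight of at least `2 (q - 1)`. -/
theorem eq_or_eq_of_weight_lt (h : AperySystem m c q ρ P D)
    (hw : ∑ x ∈ P, tailCount c m x + ∑ x ∈ D, tailCount c m x + 2 < 2 * q) {p y p' y' : ℕ}
    (hp : p ∈ P) (hp' : p' ∈ P) (hy : y ∈ D) (hy' : y' ∈ D) (hx : p + y ∈ D)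
    (hx' : p' + y' ∈ D) : p = p' ∨ y = y' := by
  by_contra! hne
  have h1 := le_sum_pair (tailCount c m) hp hp' hne.1
  have h2 := le_sum_pair (tailCount c m) hy hy' hne.2
  have h3 := h.le_add_tailCount_add_one hx
  have h4 := h.le_add_tailCount_add_one hx'
  omega

/-- For `a ≠ b` the sum `a + b + z` would have the two expressions `a + (b + z)` and `b + (a + z)`
without common terms. -/
theorem eq_of_add_add_mem (h : AperySystem m c q ρ P D)
    (hw : ∑ x ∈ P, tailCount c m x + ∑ x ∈ D, tailCount c m x + 2 < 2 * q) {a b z : ℕ}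
    (ha : a ∈ P) (hb : b ∈ P) (hz : z ∈ P ∪ D) (hx : a + b + z ∈ D) : a = b := by
  have h1 := h.closed' (mem_union_left _ ha) (mem_union_left _ hb) hz hx
  have hx' : b + a + z ∈ D := by rwa [add_comm b a]
  have h2 := h.closed' (mem_union_left _ hb) (mem_union_left _ ha) hz hx'
  rcases h.eq_or_eq_of_weight_lt hw ha hb h1 h2 (by rwa [← add_assoc]) (by rwa [← add_assoc])
    with h3 | h3 <;> omega

/-- If the total weight is less than `2 (q - 1)`, the long sums are multiples of a single
element of `P`, up to elements that are at least a fourfold sum. -/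
theorem exists_of_weight_lt (h : AperySystem m c q ρ P D)
    (hw : ∑ x ∈ P, tailCount c m x + ∑ x ∈ D, tailCount c m x + 2 < 2 * q)
    (hne : (longSums P D).Nonempty) :
    ∃ a ∈ P, a + a + a ∈ D ∧ ∀ x ∈ longSums P D, x = a + a + a ∨ x = a + a + a + a ∨
      ∃ z ∈ P ∪ D, x = a + a + a + a + z := by
  -- successive splitting of `x`: each newly split off element of `P` equals the first one
  have key : ∀ x ∈ longSums P D, ∃ a ∈ P, a + a + a ∈ D ∧ (x = a + a + a ∨ x = a + a + a + a ∨
      ∃ z ∈ P ∪ D, x = a + a + a + a + z) := by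
    intro x hx
    obtain ⟨a, ha, b, hb, z, hz, rfl⟩ := h.exists_of_mem_longSums hx
    have hxD := longSums_subset P D hx
    have haU := mem_union_left D ha
    obtain rfl := h.eq_of_add_add_mem hw ha hb hz hxD
    refine ⟨a, ha, ?_⟩
    have haz := h.closed' haU haU hz hxD
    rcases mem_union.1 hz with hzP | hzD
    · obtain rfl := h.eq_of_add_add_mem hw ha hzP haU (by rwa [add_right_comm])
      exact ⟨hxD, Or.inl rfl⟩
    obtain ⟨d, hd, e, he, rfl⟩ := h.exists_add z hzD
    have hdU := mem_union_left D hd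
    rw [← add_assoc] at haz
    have hae : a + e ∈ D := h.closed a haU e he d hdU (by rwa [add_right_comm])
    obtain rfl := h.eq_of_add_add_mem hw ha hd (mem_union_right _ hae)
      (by rwa [show a + d + (a + e) = a + a + (d + e) by ring])
    rw [← add_assoc] at hxD
    have haa := h.closed _ haU _ haU _ (mem_union_right _ hzD) (by rwa [← add_assoc])
    refine ⟨h.closed _ (mem_union_right _ haa) _ haU _ he hxD, Or.inr ?_⟩
    rcases mem_union.1 he with heP | heD
    · obtain rfl := h.eq_of_add_add_mem hw ha heP (mem_union_right _ haa)
        (by rwa [show a + e + (a + a) = a + a + a + e by ring])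
      exact Or.inl (by ring)
    obtain ⟨d, hd, f, hf, rfl⟩ := h.exists_add e heD
    have hdU := mem_union_left D hd
    have h3 : a + d + f ∈ D := by rwa [add_assoc]
    have hae' : a + f ∈ D := h.closed a haU f hf d hdU (by rwa [add_right_comm])
    have h4 : a + (a + f) ∈ D := by
      have h5 : a + f + a + (a + d) ∈ D := by
        rwa [show a + f + a + (a + d) = a + a + a + (d + f) by ring]
      have had := h.closed a haU d hdU f hf h3
      have := h.closed _ (mem_union_right _ hae') _ haU _ (mem_union_right _ had) h5
      rwa [add_comm]
    obtain rfl := h.eq_of_add_add_mem hw ha hd (mem_union_right _ h4)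
      (by rwa [show a + d + (a + (a + f)) = a + a + a + (d + f) by ring])
    exact Or.inr ⟨f, hf, by ring⟩
  obtain ⟨x, hx⟩ := hne
  obtain ⟨a, ha, ha3, -⟩ := key x hx
  refine ⟨a, ha, ha3, fun y hy => ?_⟩
  obtain ⟨b, hb, hb3, hyb⟩ := key y hy
  have haU := mem_union_left D ha
  have hbU := mem_union_left D hb
  have haa := h.closed _ haU _ haU _ haU ha3
  have hbb := h.closed _ hbU _ hbU _ hbU hb3
  have hab : a = b := by
    rcases h.eq_or_eq_of_weight_lt hw ha hb haa hbb (by rwa [← add_assoc]) (by rwa [← add_assoc])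
      with h3 | h3 <;> omega
  exact hab ▸ hyb

theorem card_longSums_le_two {a : ℕ}
    (hU : ∀ x ∈ longSums P D, x = a + a + a ∨ x = a + a + a + a) : #(longSums P D) ≤ 2 :=
  (card_le_card fun x hx => by simpa using hU x hx).trans
    (card_le_two (a := a + a + a) (b := a + a + a + a))

theorem card_longSums_le_one {a : ℕ}
    (hU : ∀ x ∈ longSums P D, x = a + a + a) : #(longSums P D) ≤ 1 :=
  (card_le_card fun x hx => by simpa using hU x hx).trans (card_singleton (a + a + a)).le

end AperySystem

/-! ### The bound for each depth -/

namespace AperySystem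

variable {m c ρ : ℕ} {P D : Finset ℕ}

theorem bound_of_longSums_eq_empty {q : ℕ} (h : AperySystem m c q ρ P D)
    (hU : longSums P D = ∅) :
    q * #D ≤ (#P + 1) * (∑ x ∈ P, tailCount c m x + ∑ x ∈ D, tailCount c m x) + ρ :=
  h.bound_of_longSums (by simp [hU])

/-- The bound at depth at most two, where there are no long sums. -/
theorem bound_of_depth_le_two {q : ℕ} (h : AperySystem m c q ρ P D) (hq : q ≤ 2) :
    q * #D ≤ (#P + 1) * (∑ x ∈ P, tailCount c m x + ∑ x ∈ D, tailCount c m x) + ρ := by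
  refine h.bound_of_longSums_eq_empty (eq_empty_of_forall_notMem fun x hx => ?_)
  obtain ⟨a, ha, b, hb, z, hz, rfl⟩ := h.exists_of_mem_longSums hx
  have h1 := h.lt_of_mem a ha
  have h2 := h.lt_of_mem b hb
  have h3 := h.mult_lt hz
  have h4 := h.lt_of_mem_dec _ (longSums_subset P D hx)
  have h5 := h.conductor_add
  have h6 : q * m ≤ 2 * m := Nat.mul_le_mul_right m hq
  omega

/-- The bound at depth at least seven: a long sum would have too large a weight. -/
theorem bound_of_seven_le_depth {q : ℕ} (h : AperySystem m c q ρ P D) (hq : 7 ≤ q)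
    (hw : q + (∑ x ∈ P, tailCount c m x + ∑ x ∈ D, tailCount c m x) ≤ 12) :
    q * #D ≤ (#P + 1) * (∑ x ∈ P, tailCount c m x + ∑ x ∈ D, tailCount c m x) + ρ := by
  refine h.bound_of_longSums_eq_empty (eq_empty_of_forall_notMem fun x hx => ?_)
  obtain ⟨a, ha, b, hb, z, hz, rfl⟩ := h.exists_of_mem_longSums hx
  have hxD := longSums_subset P D hx
  have h1 := h.closed' (mem_union_left _ ha) (mem_union_left _ hb) hz hxD
  have h2 := single_le_sum (fun _ _ => Nat.zero_le _) ha (f := tailCount c m)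
  have h3 := single_le_sum (fun _ _ => Nat.zero_le _) h1 (f := tailCount c m)
  have h4 := h.le_add_tailCount_add_one (by rwa [← add_assoc] : a + (b + z) ∈ D)
  omega

/-- The bound at depth six, where `a + a + a` is the only possible long sum. -/
theorem bound_of_depth_eq_six (h : AperySystem m c 6 ρ P D)
    (hw : 6 + (∑ x ∈ P, tailCount c m x + ∑ x ∈ D, tailCount c m x) ≤ 12) :
    6 * #D ≤ (#P + 1) * (∑ x ∈ P, tailCount c m x + ∑ x ∈ D, tailCount c m x) + ρ := by
  rcases (longSums P D).eq_empty_or_nonempty with h0 | hne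
  · exact h.bound_of_longSums_eq_empty h0
  obtain ⟨a, ha, ha3, hU⟩ := h.exists_of_weight_lt (by omega) hne
  have hc := h.conductor_add
  have hρ := h.offset_lt
  have hk := tailCount_le_iff (c := c) h.mult_pos
  have haU := mem_union_left D ha
  have haa := h.closed _ haU _ haU _ haU ha3
  have ham := h.lt_of_mem a ha
  have h3 := h.lt_of_mem_dec _ ha3
  have k2 := hk (a + a) 1
  have w1 := single_le_sum (fun _ _ => Nat.zero_le _) ha (f := tailCount c m)
  have w2 := single_le_sum (fun _ _ => Nat.zero_le _) haa (f := tailCount c m)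
  have w3 := tailCount_le_sum_pairSums (c := c) (m := m) ha ha haa
  -- otherwise `a` and `a + a` have weight at least `4 + 3`, more than the available six
  have no4 : ∀ x ∈ longSums P D, ¬ a + a + a + a ≤ x := by
    intro x hx hax
    have h4 := h.lt_of_mem_dec x (longSums_subset P D hx)
    have k1 := hk a 3
    have k2 := hk (a + a) 2
    omega
  have hU1 : #(longSums P D) ≤ 1 := card_longSums_le_one (a := a) fun x hx => by
    have := no4 x hx
    rcases hU x hx with h | h | ⟨z, -, h⟩ <;> omega
  have hn : 1 ≤ #P := card_pos.2 ⟨a, ha⟩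
  have h5 : (1 + 1) * ∑ x ∈ D, tailCount c m x ≤ (#P + 1) * ∑ x ∈ D, tailCount c m x :=
    Nat.mul_le_mul_right _ (by omega)
  exact h.bound_of_longSums (by omega)

/-- The bound at depth five, where only `a + a + a` and `a + a + a + a` can be long sums. -/
theorem bound_of_depth_eq_five (h : AperySystem m c 5 ρ P D)
    (hw : 5 + (∑ x ∈ P, tailCount c m x + ∑ x ∈ D, tailCount c m x) ≤ 12) :
    5 * #D ≤ (#P + 1) * (∑ x ∈ P, tailCount c m x + ∑ x ∈ D, tailCount c m x) + ρ := by
  rcases (longSums P D).eq_empty_or_nonempty with h0 | hne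
  · exact h.bound_of_longSums_eq_empty h0
  obtain ⟨a, ha, ha3, hU⟩ := h.exists_of_weight_lt (by omega) hne
  have hc := h.conductor_add
  have hρ := h.offset_lt
  have hk := tailCount_le_iff (c := c) h.mult_pos
  have haU := mem_union_left D ha
  have haa := h.closed _ haU _ haU _ haU ha3
  have ham := h.lt_of_mem a ha
  have h3 := h.lt_of_mem_dec _ ha3
  have w1 := single_le_sum (fun _ _ => Nat.zero_le _) ha (f := tailCount c m)
  have w2 := single_le_sum (fun _ _ => Nat.zero_le _) haa (f := tailCount c m)
  have w2' := tailCount_le_sum_pairSums (c := c) (m := m) ha ha haa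
  have w3 := le_sum_pair (tailCount c m) haa ha3 (by omega)
  have hn : 1 ≤ #P := card_pos.2 ⟨a, ha⟩
  have hm := h.card_add_card_lt
  have hcard := card_pairSums_add_card_longSums P D
  have hpair := two_mul_card_pairSums_le P D
  -- an even longer sum would force the weights of `a`, `2a`, `3a` up to `4 + 3 + 2`
  have hU' : ∀ x ∈ longSums P D, x = a + a + a ∨ x = a + a + a + a := by
    intro x hx
    rcases hU x hx with h1 | h1 | ⟨z, hz, rfl⟩
    · exact Or.inl h1
    · exact Or.inr h1
    · have h4 := h.lt_of_mem_dec _ (longSums_subset P D hx)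
      have hzm := h.mult_lt hz
      have k1 := hk a 3
      have k2 := hk (a + a) 2
      have k3 := hk (a + a + a) 1
      omega
  -- the bound via long sums fails only if `#P = 1`, or if `#P = 2` and `a + a` has tail count one;
  -- then `#D` is small enough for a direct comparison
  by_cases h4 : a + a + a + a ∈ longSums P D
  · have h4' := h.lt_of_mem_dec _ (longSums_subset P D h4)
    have hU2 := card_longSums_le_two hU'
    have k1 := hk a 2
    have k1' := hk a 3
    have k2 := hk (a + a) 1
    have k2' := hk (a + a) 2
    have k3 := hk (a + a + a) 0
    rcases Nat.lt_or_ge 1 (#P) with hn2 | hn1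
    · have h5 : (2 + 1) * ∑ x ∈ D, tailCount c m x ≤ (#P + 1) * ∑ x ∈ D, tailCount c m x :=
        Nat.mul_le_mul_right _ (by omega)
      exact h.bound_of_longSums (by omega)
    · have hP : #P = 1 := by omega
      rw [hP] at hpair hm ⊢
      omega
  · have hU1 : #(longSums P D) ≤ 1 := card_longSums_le_one (a := a) fun x hx =>
      (hU' x hx).resolve_right fun e => h4 (e ▸ hx)
    have k1 := hk a 2
    have k2 := hk (a + a) 1
    have k2' := hk (a + a) 0
    rcases Nat.lt_or_ge 1 (tailCount c m (a + a)) with hk2 | hk2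
    · have h5 : (1 + 1) * ∑ x ∈ D, tailCount c m x ≤ (#P + 1) * ∑ x ∈ D, tailCount c m x :=
        Nat.mul_le_mul_right _ (by omega)
      exact h.bound_of_longSums (by omega)
    rcases Nat.lt_or_ge 2 (#P) with hn2 | hn2
    · have h5 : (3 + 1) * ∑ x ∈ D, tailCount c m x ≤ (#P + 1) * ∑ x ∈ D, tailCount c m x :=
        Nat.mul_le_mul_right _ (by omega)
      exact h.bound_of_longSums (by omega)
    obtain hP | hP : #P = 1 ∨ #P = 2 := by omega
    · rw [hP] at hpair hm ⊢
      omega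
    · obtain ⟨b, hb⟩ := card_eq_one.1 (by rw [card_erase_of_mem ha, hP] : #(P.erase a) = 1)
      obtain ⟨hba, hbP⟩ := mem_erase.1 (hb ▸ mem_singleton_self b : b ∈ P.erase a)
      have hPab : ∀ p ∈ P, p = a ∨ p = b := by
        intro p hp
        by_cases hpa : p = a
        · exact Or.inl hpa
        · exact Or.inr (mem_singleton.1 (hb ▸ mem_erase.2 ⟨hpa, hp⟩))
      have w1' := le_sum_pair (tailCount c m) ha hbP hba.symm
      have kb := h.one_le_tailCount hbP
      rw [hP] at hpair ⊢
      by_cases h2b : b + b ∈ D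
      · have h2b' := h.lt_of_mem_dec _ h2b
        have kb' := hk b 1
        omega
      · have : #(pairSums P D) ≤ 2 := by
          refine (card_le_card fun x hx => ?_).trans (card_le_two (a := a + a) (b := a + b))
          obtain ⟨hxD, p, hp, p', hp', rfl⟩ := mem_filter.1 hx
          rcases hPab p hp with rfl | rfl <;> rcases hPab p' hp' with rfl | rfl
          · simp
          · simp
          · simp [add_comm]
          · exact absurd hxD h2b
        omega

/-- At depth four, a long sum that is not a sum of three elements of `P` has the form
`a + a + a + a`. -/
theorem eq_of_depth_eq_four (h : AperySystem m c 4 ρ P D)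
    (hw : 4 + (∑ x ∈ P, tailCount c m x + ∑ x ∈ D, tailCount c m x) ≤ 12) {x : ℕ}
    (hx : x ∈ longSums P D) (h3 : ¬ ∃ a ∈ P, ∃ b ∈ P, ∃ z ∈ P, x = a + b + z) :
    ∃ a ∈ P, a + a ∈ D ∧ a + a + a ∈ D ∧ x = a + a + a + a := by
  have hc := h.conductor_add
  have hk := tailCount_le_iff (c := c) h.mult_pos
  -- for `a ≠ b` the weight would be at least `3 + 3` from `P` and `2 + 2` from `D`
  have key : ∀ a ∈ P, ∀ b ∈ P, ∀ z ∈ D, a + b + z ∈ D → a = b := by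
    intro a ha b hb z hz hD
    by_contra hab
    obtain ⟨d, hd, e, he, rfl⟩ := h.exists_add z hz
    have haU := mem_union_left D ha
    have hbU := mem_union_left D hb
    have hdU := mem_union_left D hd
    have h1 := h.lt_of_mem a ha
    have h2 := h.lt_of_mem b hb
    have h3 := h.lt_of_mem d hd
    have h4 := h.mult_lt he
    have hlt := h.lt_of_mem_dec _ hD
    have hbz := h.closed' haU hbU (mem_union_right _ hz) hD
    have haz := h.closed' hbU haU (mem_union_right _ hz) (by rwa [add_comm b a])
    have hbe := h.closed b hbU e he d hdU (by rwa [add_assoc, add_comm e d])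
    have hae := h.closed a haU e he d hdU (by rwa [add_assoc, add_comm e d])
    have had := h.closed a haU d hdU (b + e) (mem_union_right _ hbe)
      (by rwa [show a + d + (b + e) = a + b + (d + e) by ring])
    have hbd := h.closed b hbU d hdU (a + e) (mem_union_right _ hae)
      (by rwa [show b + d + (a + e) = a + b + (d + e) by ring])
    have k1 := hk a 2
    have k2 := hk b 2
    have k3 := hk (a + d) 1
    have k4 := hk (b + d) 1
    have w1 := le_sum_pair (tailCount c m) ha hb hab
    have w2 := le_sum_pair (tailCount c m) had hbd (by omega)
    omega
  obtain ⟨a, ha, b, hb, z, hz, rfl⟩ := h.exists_of_mem_longSums hx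
  have hxD := longSums_subset P D hx
  rcases mem_union.1 hz with hzP | hzD
  · exact absurd ⟨a, ha, b, hb, z, hzP, rfl⟩ h3
  obtain rfl := key a ha b hb z hzD hxD
  obtain ⟨d, hd, e, he, rfl⟩ := h.exists_add z hzD
  have haU := mem_union_left D ha
  have hdU := mem_union_left D hd
  have haz := h.closed' haU haU hz hxD
  have hae := h.closed a haU e he d hdU (by rwa [add_assoc, add_comm e d])
  obtain rfl := key a ha d hd (a + e) hae
    (by rwa [show a + d + (a + e) = a + a + (d + e) by ring])
  have haa := h.closed a haU a haU _ hz hxD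
  rcases mem_union.1 he with heP | heD
  · obtain rfl := key a ha e heP (a + a) haa
      (by rwa [show a + e + (a + a) = a + a + (a + e) by ring])
    rw [← add_assoc] at hxD ⊢
    exact ⟨a, ha, haa, h.closed _ (mem_union_right _ haa) a haU a haU hxD, rfl⟩
  · have h1 := h.lt_of_mem a ha
    have h2 := h.two_mul_lt heD
    have h4 := h.lt_of_mem_dec _ hxD
    omega

/-- The bound at depth four when some long sum is not a sum of three elements of `P`. Then the
multiples of a single `a ∈ P` use up so much weight that no other long sums exist. -/
theorem bound_of_not_triple (h : AperySystem m c 4 ρ P D)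
    (hw : 4 + (∑ x ∈ P, tailCount c m x + ∑ x ∈ D, tailCount c m x) ≤ 12) {x : ℕ}
    (hx : x ∈ longSums P D) (h3 : ¬ ∃ a ∈ P, ∃ b ∈ P, ∃ z ∈ P, x = a + b + z) :
    4 * #D ≤ (#P + 1) * (∑ x ∈ P, tailCount c m x + ∑ x ∈ D, tailCount c m x) + ρ := by
  obtain ⟨a, ha, h2a, h3a, rfl⟩ := h.eq_of_depth_eq_four hw hx h3
  have hc := h.conductor_add
  have hk := tailCount_le_iff (c := c) h.mult_pos
  have haU := mem_union_left D ha
  have ham := h.lt_of_mem a ha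
  have h4 := h.lt_of_mem_dec _ (longSums_subset P D hx)
  have k1 := hk a 2
  have k2 := hk (a + a) 1
  have k3 := hk (a + a + a) 0
  have w1 := single_le_sum (fun _ _ => Nat.zero_le _) ha (f := tailCount c m)
  have w3 := le_sum_pair (tailCount c m) h2a h3a (by omega)
  have w2 := tailCount_le_sum_pairSums (c := c) (m := m) ha ha h2a
  -- `a`, `a + a`, `a + a + a` have weight at least `3 + 2 + 1`, and a further `b` at least `2`, so
  -- that no weight is left for other elements
  have key : ∀ b ∈ P, ∀ d ∈ P, ∀ e ∈ P, b + d + e ∈ D → b = a := by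
    intro b hb d hd e he hD
    by_contra hba
    have hbU := mem_union_left D hb
    have hdU := mem_union_left D hd
    have heU := mem_union_left D he
    have hbm := h.lt_of_mem b hb
    have hdm := h.lt_of_mem d hd
    have hem := h.lt_of_mem e he
    have hlt := h.lt_of_mem_dec _ hD
    have kb := hk b 1
    have w4 := le_sum_pair (tailCount c m) ha hb (Ne.symm hba)
    have honly : ∀ y ∈ D, ∀ z ∈ P ∪ D, y + z ∈ D → y = a + a ∨ y = a + a + a := by
      intro y hy z hz hyz
      by_contra! hne
      have w5 := le_sum_triple (tailCount c m) h2a h3a hy (by omega) hne.1.symm hne.2.symm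
      have := h.one_le_tailCount_of_add_mem hz hyz
      omega
    have hP : ∀ p ∈ P, p = a ∨ p = b := by
      intro p hp
      by_contra! hne
      have w5 := le_sum_triple (tailCount c m) ha hb hp (Ne.symm hba) hne.1.symm hne.2.symm
      have := h.one_le_tailCount hp
      omega
    have hPD : ∀ p ∈ P, p ∉ D := fun p hp hp' => disjoint_left.1 h.disj hp hp'
    have hab : ∀ z ∈ P ∪ D, a + b + z ∈ D → False := by
      intro z hz hz'
      rcases honly _ (h.closed a haU b hbU z hz hz') z hz hz' with h5 | h5
      · omega
      · exact hPD b hb (by rwa [show b = a + a by omega])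
    have hDae : b + e + d ∈ D := by rwa [add_right_comm]
    have hda : d = b := (hP d hd).resolve_left fun hda => by
      subst hda
      exact hab e heU (by rwa [add_comm d b])
    have hea : e = b := (hP e he).resolve_left fun hea => by
      subst hea
      exact hab d hdU (by rwa [add_comm e b])
    subst hda hea
    rcases honly _ (h.closed _ hbU _ hbU _ hbU hD) _ hbU hD with h5 | h5
    · omega
    · exact hab (a + a) (mem_union_right _ h2a)
        (by rwa [show a + e + (a + a) = e + e + e by omega])
  have hU : ∀ x ∈ longSums P D, x = a + a + a ∨ x = a + a + a + a := by
    intro x hx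
    by_cases h3 : ∃ b ∈ P, ∃ d ∈ P, ∃ e ∈ P, x = b + d + e
    · obtain ⟨b, hb, d, hd, e, he, rfl⟩ := h3
      have hD := longSums_subset P D hx
      obtain rfl := key b hb d hd e he hD
      obtain rfl := key d hd b hb e he (by rwa [add_comm d b])
      obtain rfl := key e he d hd d hd (by rwa [show e + d + d = d + d + e by ring])
      exact Or.inl rfl
    · obtain ⟨b, hb, -, hb3, rfl⟩ := h.eq_of_depth_eq_four hw hx h3
      obtain rfl := key b hb b hb b hb hb3
      exact Or.inr rfl
  have hU2 := card_longSums_le_two hU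
  rcases Nat.lt_or_ge 1 (#P) with hn2 | hn1
  · have h5 : (2 + 1) * ∑ x ∈ D, tailCount c m x ≤ (#P + 1) * ∑ x ∈ D, tailCount c m x :=
      Nat.mul_le_mul_right _ (by omega)
    exact h.bound_of_longSums (by omega)
  · have hn : 1 ≤ #P := card_pos.2 ⟨a, ha⟩
    have hP : #P = 1 := by omega
    have hcard := card_pairSums_add_card_longSums P D
    have hpair := two_mul_card_pairSums_le P D
    rw [hP] at hpair ⊢
    omega

/-- A lower bound for a sum over `P` of a function that is positive on `P` and at least `2` on
`V`. -/
theorem card_add_card_le_sum {P V : Finset ℕ} {f : ℕ → ℕ} (hV : V ⊆ P)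
    (h1 : ∀ x ∈ P, 1 ≤ f x) (h2 : ∀ x ∈ V, 2 ≤ f x) : #P + #V ≤ ∑ x ∈ P, f x := by
  classical
  rw [← sum_sdiff hV, ← card_sdiff_add_card_eq_card hV]
  have h3 : #(P \ V) ≤ ∑ x ∈ P \ V, f x := by
    simpa using card_nsmul_le_sum (P \ V) f 1 fun x hx => h1 x (mem_sdiff.1 hx).1
  have h4 : #V * 2 ≤ ∑ x ∈ V, f x := by simpa using card_nsmul_le_sum V f 2 h2
  omega

/-- The bound when the long sums are outnumbered by the pair sums below the conductor, each of
which contributes at least one to the weight. -/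
theorem bound_of_card_longSums_le {q : ℕ} (h : AperySystem m c q ρ P D)
    (hU : #(longSums P D) ≤ #(lowPairs c P D)) (hq : q ≤ #P + 2) :
    q * #D ≤ (#P + 1) * (∑ x ∈ P, tailCount c m x + ∑ x ∈ D, tailCount c m x) + ρ := by
  refine h.bound_of_longSums ?_
  have h1 := h.card_lowPairs_le
  have h2 := sum_pairSums_le P D (tailCount c m)
  calc q * #(longSums P D) ≤ (#P + 1 + 1) * #(lowPairs c P D) := Nat.mul_le_mul hq hU
    _ = (#P + 1) * #(lowPairs c P D) + #(lowPairs c P D) := by ring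
    _ ≤ _ := add_le_add (Nat.mul_le_mul_left _ (h1.trans h2)) h1

/-- The bound at depth four. If the long sums are triple sums, they are compared with the pair sums
below the conductor that divide them. -/
theorem bound_of_depth_eq_four (h : AperySystem m c 4 ρ P D)
    (hw : 4 + (∑ x ∈ P, tailCount c m x + ∑ x ∈ D, tailCount c m x) ≤ 12) :
    4 * #D ≤ (#P + 1) * (∑ x ∈ P, tailCount c m x + ∑ x ∈ D, tailCount c m x) + ρ := by
  by_cases htr : ∀ x ∈ longSums P D, ∃ a ∈ P, ∃ b ∈ P, ∃ z ∈ P, x = a + b + z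
  swap
  · push Not at htr
    obtain ⟨x, hx, h3⟩ := htr
    exact h.bound_of_not_triple hw hx (by push Not; exact h3)
  rcases (longSums P D).eq_empty_or_nonempty with h0 | ⟨x, hx⟩
  · exact h.bound_of_longSums_eq_empty h0
  have hc := h.conductor_add
  have hρ := h.offset_lt
  have hk := tailCount_le_iff (c := c) h.mult_pos
  have hcard := card_pairSums_add_card_longSums P D
  have hpair := two_mul_card_pairSums_le P D
  have hm := h.card_add_card_lt
  have hn : 1 ≤ #P := by
    obtain ⟨a, ha, -⟩ := htr x hx
    exact card_pos.2 ⟨a, ha⟩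
  have hcl : ∀ a ∈ P, ∀ b ∈ P, ∀ z ∈ P, a + b + z ∈ longSums P D → a + b ∈ lowPairs c P D :=
    fun a ha b hb z hz hx =>
      h.add_mem_lowPairs ha hb (mem_union_left _ hz) (longSums_subset P D hx)
  rcases Nat.lt_or_ge 1 (#P) with hn2 | hn1
  · rcases Nat.lt_or_ge 2 #(lowPairs c P D) with hs | hs
    swap
    · exact h.bound_of_card_longSums_le (card_le_of_card_le_two htr hcl hs) (by omega)
    have hQ := h.card_lowPairs_le
    have hK := sum_pairSums_le P D (tailCount c m)
    have hV2 : ∀ a ∈ tripleSupport P (longSums P D), 2 ≤ tailCount c m a := by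
      intro a ha
      obtain ⟨ha, b, hb, z, hz, hx⟩ := mem_filter.1 ha
      have h1 := h.lt_of_mem b hb
      have h2 := h.lt_of_mem z hz
      have h3 := h.lt_of_mem_dec _ (longSums_subset P D hx)
      have k1 := hk a 1
      omega
    have hV : tripleSupport P (longSums P D) ⊆ P := filter_subset _ _
    have hVP := card_le_card hV
    have hsum := card_add_card_le_sum hV (fun x hx => h.one_le_tailCount hx) hV2
    have hV' : #(tripleSupport P (longSums P D)) ≤ 2 := by omega
    rcases card_le_four htr hV' with h3 | ⟨hU4, a, ha, b, hb, hab, ha3, hb3⟩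
    · have h5 : (2 + 1) * ∑ x ∈ D, tailCount c m x ≤ (#P + 1) * ∑ x ∈ D, tailCount c m x :=
        Nat.mul_le_mul_right _ (by omega)
      exact h.bound_of_longSums (by omega)
    -- `a + a + a` and `b + b + b` lie in `D`, and one of `a`, `b` has tail count two, as otherwise
    -- the weight would exceed eight; this forces `m < 2 ρ`, and `ρ` is large as `#P + #D < m`
    have hsum' := add_add_card_le_sum (fun x hx => h.one_le_tailCount hx) ha hb hab
    have ka := hV2 a (mem_filter.2 ⟨ha, a, ha, a, ha, ha3⟩)
    have kb := hV2 b (mem_filter.2 ⟨hb, b, hb, b, hb, hb3⟩)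
    have ka' := hk a 2
    have kb' := hk b 2
    have ha4 := h.lt_of_mem_dec _ (longSums_subset P D ha3)
    have hb4 := h.lt_of_mem_dec _ (longSums_subset P D hb3)
    obtain hP | hP : #P = 2 ∨ #P = 3 := by omega
    all_goals
      rw [hP] at hpair ⊢
      omega
  · have hP : #P = 1 := by omega
    obtain ⟨a, rfl⟩ := card_eq_one.1 hP
    simp only [mem_singleton, exists_eq_left] at htr
    have hU1 := card_longSums_le_one htr
    have ha : a ∈ ({a} : Finset ℕ) := mem_singleton_self a
    have ha3 : a + a + a ∈ D := by
      rw [← htr x hx]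
      exact longSums_subset _ D hx
    have haU := mem_union_left D ha
    have h2a := h.closed _ haU _ haU _ haU ha3
    have ham := h.lt_of_mem a ha
    have h3 := h.lt_of_mem_dec _ ha3
    have w1 := single_le_sum (fun _ _ => Nat.zero_le _) ha (f := tailCount c m)
    have w2 := single_le_sum (fun _ _ => Nat.zero_le _) h2a (f := tailCount c m)
    have k1 := hk a 1
    have k1' := hk a 2
    have k2 := hk (a + a) 0
    have k2' := hk (a + a) 1
    rw [hP] at hpair hm ⊢
    omega

/-- The bound at depth three, where all long sums are triple sums. -/
theorem bound_of_depth_eq_three (h : AperySystem m c 3 ρ P D)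
    (hw : 3 + (∑ x ∈ P, tailCount c m x + ∑ x ∈ D, tailCount c m x) ≤ 12) :
    3 * #D ≤ (#P + 1) * (∑ x ∈ P, tailCount c m x + ∑ x ∈ D, tailCount c m x) + ρ := by
  rcases (longSums P D).eq_empty_or_nonempty with h0 | ⟨x, hx⟩
  · exact h.bound_of_longSums_eq_empty h0
  have hc := h.conductor_add
  have hk := tailCount_le_iff (c := c) h.mult_pos
  have htr : ∀ x ∈ longSums P D, ∃ a ∈ P, ∃ b ∈ P, ∃ z ∈ P, x = a + b + z := by
    intro x hx
    obtain ⟨a, ha, b, hb, z, hz, rfl⟩ := h.exists_of_mem_longSums hx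
    rcases mem_union.1 hz with hz | hz
    · exact ⟨a, ha, b, hb, z, hz, rfl⟩
    · have h1 := h.lt_of_mem a ha
      have h2 := h.lt_of_mem b hb
      have h3 := h.two_mul_lt hz
      have h4 := h.lt_of_mem_dec _ (longSums_subset P D hx)
      omega
  have hcard := card_pairSums_add_card_longSums P D
  have hpair := two_mul_card_pairSums_le P D
  have hn : 1 ≤ #P := by
    obtain ⟨a, ha, -⟩ := htr x hx
    exact card_pos.2 ⟨a, ha⟩
  have hcl : ∀ a ∈ P, ∀ b ∈ P, ∀ z ∈ P, a + b + z ∈ longSums P D → a + b ∈ lowPairs c P D :=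
    fun a ha b hb z hz hx =>
      h.add_mem_lowPairs ha hb (mem_union_left _ hz) (longSums_subset P D hx)
  rcases Nat.lt_or_ge 2 #(lowPairs c P D) with hs | hs
  swap
  · exact h.bound_of_card_longSums_le (card_le_of_card_le_two htr hcl hs) (by omega)
  have hQ := h.card_lowPairs_le
  have hK := sum_pairSums_le P D (tailCount c m)
  have hQ' : #(lowPairs c P D) ≤ #(pairSums P D) := card_filter_le _ _
  have hV2 : ∀ a ∈ tripleSupport P (longSums P D), 2 ≤ tailCount c m a := by
    intro a ha
    obtain ⟨ha, b, hb, z, hz, hx⟩ := mem_filter.1 ha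
    have h1 := h.lt_of_mem b hb
    have h2 := h.lt_of_mem z hz
    have h3 := h.lt_of_mem_dec _ (longSums_subset P D hx)
    have k1 := hk a 1
    omega
  have hV : tripleSupport P (longSums P D) ⊆ P := filter_subset _ _
  have hVP := card_le_card hV
  have hsum := card_add_card_le_sum hV (fun x hx => h.one_le_tailCount hx) hV2
  rcases Nat.lt_or_ge 2 #(tripleSupport P (longSums P D)) with hV3 | hV3
  · -- all the weight is used: `#P = 3` and there are three pair sums below the conductor, so that
    -- `#D ≤ 6 + 6` by counting pair sums and long sums separately
    have hP : #P = 3 := by omega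
    have hC := two_mul_card_le htr hcl
    rw [hP] at hpair hC ⊢
    omega
  · have hn2 : 2 ≤ #P := by
      by_contra! hlt
      have hP : #P = 1 := by omega
      rw [hP] at hpair
      omega
    have h5 : (2 + 1) * ∑ x ∈ D, tailCount c m x ≤ (#P + 1) * ∑ x ∈ D, tailCount c m x :=
      Nat.mul_le_mul_right _ (by omega)
    have hU4 : #(longSums P D) ≤ 4 := by
      rcases card_le_four htr hV3 with h | h <;> omega
    exact h.bound_of_longSums (by omega)

/-- The combinatorial core: the number of decomposable Apéry elements is bounded in terms of the
total weight, provided that depth and weight add up to at most twelve. -/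
theorem bound {q : ℕ} (h : AperySystem m c q ρ P D)
    (hw : q + (∑ x ∈ P, tailCount c m x + ∑ x ∈ D, tailCount c m x) ≤ 12) :
    q * #D ≤ (#P + 1) * (∑ x ∈ P, tailCount c m x + ∑ x ∈ D, tailCount c m x) + ρ := by
  rcases Nat.lt_or_ge 6 q with hq | hq
  · exact h.bound_of_seven_le_depth hq hw
  rcases Nat.lt_or_ge 2 q with hq' | hq'
  · obtain rfl | rfl | rfl | rfl : q = 3 ∨ q = 4 ∨ q = 5 ∨ q = 6 := by omega
    · exact h.bound_of_depth_eq_three hw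
    · exact h.bound_of_depth_eq_four hw
    · exact h.bound_of_depth_eq_five hw
    · exact h.bound_of_depth_eq_six hw
  · exact h.bound_of_depth_le_two hq'

end AperySystem

/-! ### The Apéry system of a numerical semigroup -/

variable {S : AddSubmonoid ℕ}

namespace IsNumericalSemigroup

theorem conductor_spec (hS : IsNumericalSemigroup S) {n : ℕ} (hn : conductor S ≤ n) : n ∈ S := by
  have hne : {c : ℕ | Set.Ici c ⊆ (S : Set ℕ)}.Nonempty := by
    obtain ⟨b, hb⟩ := Set.Finite.bddAbove hS
    refine ⟨b + 1, fun n hn => ?_⟩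
    by_contra hnS
    have := hb hnS
    rw [Set.mem_Ici] at hn
    omega
  exact Nat.sInf_mem hne hn

theorem multiplicity_mem_star (hS : IsNumericalSemigroup S) : multiplicity S ∈ star S :=
  Nat.sInf_mem (s := star S) ⟨conductor S + 1, hS.conductor_spec (by omega), by simp⟩

theorem multiplicity_mem (hS : IsNumericalSemigroup S) : multiplicity S ∈ S :=
  hS.multiplicity_mem_star.1

theorem multiplicity_pos (hS : IsNumericalSemigroup S) : 0 < multiplicity S :=
  Nat.pos_of_ne_zero hS.multiplicity_mem_star.2

theorem conductor_le_depth_mul (hS : IsNumericalSemigroup S) :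
    conductor S ≤ depth S * multiplicity S := by
  have hm : (0 : ℚ) < multiplicity S := by exact_mod_cast hS.multiplicity_pos
  have h := Nat.le_ceil ((conductor S : ℚ) / multiplicity S)
  rw [div_le_iff₀ hm] at h
  exact_mod_cast h

theorem depth_mul_lt (hS : IsNumericalSemigroup S) :
    depth S * multiplicity S < conductor S + multiplicity S := by
  have hm : (0 : ℚ) < multiplicity S := by exact_mod_cast hS.multiplicity_pos
  have h := Nat.ceil_lt_add_one (show (0 : ℚ) ≤ (conductor S : ℚ) / multiplicity S by positivity)
  rw [← sub_lt_iff_lt_add, lt_div_iff₀ hm, sub_mul, one_mul, sub_lt_iff_lt_add] at h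
  exact_mod_cast h

end IsNumericalSemigroup

theorem multiplicity_le {x : ℕ} (hx : x ∈ star S) : multiplicity S ≤ x := Nat.sInf_le hx

theorem mem_decomposables {x : ℕ} :
    x ∈ decomposables S ↔ ∃ a ∈ star S, ∃ b ∈ star S, x = a + b := by
  refine ⟨fun ⟨h1, h2⟩ => ?_, fun h => ⟨?_, fun h2 => h2.2 h⟩⟩
  · by_contra h3
    exact h2 ⟨h1, h3⟩
  · obtain ⟨a, ha, b, hb, rfl⟩ := h
    exact ⟨S.add_mem ha.1 hb.1, fun h => ha.2 (Nat.eq_zero_of_add_eq_zero_right h)⟩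

theorem exists_primitive_add {x : ℕ} (hx : x ∈ star S) :
    ∃ p ∈ primitives S, ∃ y ∈ S, x = p + y := by
  induction x using Nat.strong_induction_on with
  | _ x ih =>
    by_cases hp : x ∈ primitives S
    · exact ⟨x, hp, 0, S.zero_mem, rfl⟩
    · obtain ⟨a, ha, b, hb, rfl⟩ := mem_decomposables.1 ⟨hx, hp⟩
      have hb0 : b ≠ 0 := hb.2
      obtain ⟨p, hpP, y, hy, rfl⟩ := ih a (by omega) ha
      exact ⟨p, hpP, y + b, S.add_mem hy hb.1, by ring⟩

open Classical in
/-- The nonzero Apéry elements of `S` with respect to the multiplicity `m`: the nonzero elements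
`x` of `S` such that `x - m` is not in `S`. All of them are below `c + m`. -/
noncomputable def apery (S : AddSubmonoid ℕ) : Finset ℕ :=
  {x ∈ range (conductor S + multiplicity S) | x ∈ star S ∧ ¬ ∃ y ∈ S, x = y + multiplicity S}

open Classical in
/-- The primitive elements below the conductor, other than the multiplicity. -/
noncomputable def aperyPrimitives (S : AddSubmonoid ℕ) : Finset ℕ :=
  {x ∈ apery S | x ∈ primitives S ∧ x < conductor S}

open Classical in
/-- The decomposable Apéry elements. -/
noncomputable def aperyDecomposables (S : AddSubmonoid ℕ) : Finset ℕ :=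
  {x ∈ apery S | x ∈ decomposables S}

theorem mem_apery {x : ℕ} : x ∈ apery S ↔
    x < conductor S + multiplicity S ∧ x ∈ star S ∧ ¬ ∃ y ∈ S, x = y + multiplicity S := by
  simp [apery]

theorem mem_aperyPrimitives {x : ℕ} :
    x ∈ aperyPrimitives S ↔ x ∈ apery S ∧ x ∈ primitives S ∧ x < conductor S := by
  simp [aperyPrimitives]

theorem mem_aperyDecomposables {x : ℕ} :
    x ∈ aperyDecomposables S ↔ x ∈ apery S ∧ x ∈ decomposables S := by
  simp [aperyDecomposables]

theorem mem_apery_of_add {x y : ℕ} (hx : x ∈ star S) (hy : y ∈ S) (h : x + y ∈ apery S) :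
    x ∈ apery S := by
  rw [mem_apery] at h ⊢
  refine ⟨by omega, hx, fun ⟨z, hz, hxz⟩ => h.2.2 ⟨z + y, S.add_mem hz hy, ?_⟩⟩
  omega

theorem mem_union_of_mem_apery {x : ℕ} (hx : x ∈ apery S) (hc : x < conductor S) :
    x ∈ aperyPrimitives S ∪ aperyDecomposables S := by
  by_cases hp : x ∈ primitives S
  · exact mem_union_left _ (by simp [aperyPrimitives, hx, hp, hc])
  · have : x ∈ decomposables S := ⟨(mem_apery.1 hx).2.1, hp⟩
    exact mem_union_right _ (by simp [aperyDecomposables, hx, this])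

theorem mem_apery_of_mem_union {x : ℕ} (hx : x ∈ aperyPrimitives S ∪ aperyDecomposables S) :
    x ∈ apery S := by
  rcases mem_union.1 hx with hx | hx
  · exact (mem_aperyPrimitives.1 hx).1
  · exact (mem_aperyDecomposables.1 hx).1

/-- An Apéry element is the least element of `S` in its residue class modulo `m`. -/
theorem eq_of_mod_eq (hS : IsNumericalSemigroup S) {x y : ℕ} (hx : x ∈ S) (hy : y ∈ apery S)
    (hxy : x ≤ y) (h : x % multiplicity S = y % multiplicity S) : x = y := by
  obtain ⟨j, hj⟩ := (Nat.modEq_iff_dvd' hxy).1 h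
  rcases Nat.eq_zero_or_pos j with rfl | hj0
  · omega
  obtain ⟨i, rfl⟩ := Nat.exists_eq_add_of_le' hj0
  refine absurd ⟨x + i • multiplicity S,
    S.add_mem hx (S.nsmul_mem hS.multiplicity_mem i), ?_⟩ (mem_apery.1 hy).2.2
  have : y = x + multiplicity S * (i + 1) := (Nat.add_sub_of_le hxy).symm.trans (by rw [hj])
  rw [this, smul_eq_mul]
  ring

/-- The combinatorial data attached to a numerical semigroup. -/
theorem aperySystem (hS : IsNumericalSemigroup S) :
    AperySystem (multiplicity S) (conductor S) (depth S)
      (depth S * multiplicity S - conductor S) (aperyPrimitives S) (aperyDecomposables S) where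
  offset_lt := by
    have := hS.depth_mul_lt
    have := hS.multiplicity_pos
    omega
  conductor_add := by
    have := hS.conductor_le_depth_mul
    omega
  disj := disjoint_left.2 fun x hx hx' =>
    (mem_aperyDecomposables.1 hx').2.2 (mem_aperyPrimitives.1 hx).2.1
  lt_of_mem p hp := by
    have h1 := mem_apery.1 (mem_aperyPrimitives.1 hp).1
    refine lt_of_le_of_ne (multiplicity_le h1.2.1) fun e => h1.2.2 ⟨0, S.zero_mem, ?_⟩
    omega
  lt_conductor p hp := (mem_aperyPrimitives.1 hp).2.2
  lt_of_mem_dec x hx := (mem_apery.1 (mem_aperyDecomposables.1 hx).1).1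
  exists_add x hx := by
    obtain ⟨hxA, hxD⟩ := mem_aperyDecomposables.1 hx
    obtain ⟨a, ha, b, hb, rfl⟩ := mem_decomposables.1 hxD
    obtain ⟨p, hp, y, hy, rfl⟩ := exists_primitive_add ha
    rw [add_assoc] at hxA
    have hyb : y + b ∈ star S := by
      exact ⟨S.add_mem hy hb.1, fun h => hb.2 (Nat.eq_zero_of_add_eq_zero_left h)⟩
    have h1 := multiplicity_le hp.1
    have h2 := multiplicity_le hyb
    have h3 := (mem_apery.1 hxA).1
    refine ⟨p, mem_aperyPrimitives.2 ⟨mem_apery_of_add hp.1 hyb.1 hxA, hp, by omega⟩, y + b, ?_,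
      by ring⟩
    rw [add_comm] at hxA
    exact mem_union_of_mem_apery (mem_apery_of_add hyb hp.1.1 hxA) (by omega)
  closed a ha b hb z hz hx := by
    have ha' := (mem_apery.1 (mem_apery_of_mem_union ha)).2.1
    have hb' := (mem_apery.1 (mem_apery_of_mem_union hb)).2.1
    have hz' := (mem_apery.1 (mem_apery_of_mem_union hz)).2.1
    have hab : a + b ∈ decomposables S := mem_decomposables.2 ⟨a, ha', b, hb', rfl⟩
    exact mem_aperyDecomposables.2
      ⟨mem_apery_of_add hab.1 hz'.1 (mem_aperyDecomposables.1 hx).1, hab⟩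
  mod_inj x hx y hy hxy := by
    have hx' := mem_apery_of_mem_union hx
    have hy' := mem_apery_of_mem_union hy
    rcases le_total x y with h | h
    · exact eq_of_mod_eq hS (mem_apery.1 hx').2.1.1 hy' h hxy
    · exact (eq_of_mod_eq hS (mem_apery.1 hy').2.1.1 hx' h hxy.symm).symm
  mod_ne x hx h := by
    have hx' := mem_apery_of_mem_union hx
    exact (mem_apery.1 hx').2.1.2
      (eq_of_mod_eq hS S.zero_mem hx' (Nat.zero_le _) (by simpa using h.symm)).symm

open Classical in
/-- The left part as a finset. -/
noncomputable def leftFinset (S : AddSubmonoid ℕ) : Finset ℕ := {x ∈ range (conductor S) | x ∈ S}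

theorem mem_leftFinset {x : ℕ} : x ∈ leftFinset S ↔ x < conductor S ∧ x ∈ S := by
  simp [leftFinset]

theorem coe_leftFinset : (leftFinset S : Set ℕ) = leftPart S := by
  ext x
  simp [leftFinset, leftPart, and_comm]

theorem ncard_leftPart : (leftPart S).ncard = #(leftFinset S) := by
  rw [← coe_leftFinset, Set.ncard_coe_finset]

/-- The left part contains the multiples of `m` below `c`, and the elements below `c` of the
progressions `x + m ℕ`, for `x` an Apéry element; these progressions are disjoint. -/
theorem depth_add_weight_le (hS : IsNumericalSemigroup S) :
    depth S + (∑ x ∈ aperyPrimitives S, tailCount (conductor S) (multiplicity S) x +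
      ∑ x ∈ aperyDecomposables S, tailCount (conductor S) (multiplicity S) x) ≤
      #(leftFinset S) := by
  have h := aperySystem hS
  have hm := hS.multiplicity_pos
  set m := multiplicity S
  set c := conductor S
  have h0 : 0 ∉ aperyPrimitives S ∪ aperyDecomposables S := fun h0 =>
    (mem_apery.1 (mem_apery_of_mem_union h0)).2.1.2 rfl
  have hk0 : depth S ≤ tailCount c m 0 := by
    have h1 := le_add_tailCount (c := c) hm 0
    by_contra! hlt
    have h2 := hS.depth_mul_lt
    have h3 : (tailCount c m 0 + 1) * m ≤ depth S * m := Nat.mul_le_mul_right _ hlt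
    rw [add_mul] at h3
    simp only [c, m] at h1 h2 h3
    omega
  have hA : ∀ x ∈ insert 0 (aperyPrimitives S ∪ aperyDecomposables S), x ∈ S := by
    intro x hx
    rcases mem_insert.1 hx with rfl | hx
    · exact S.zero_mem
    · exact (mem_apery.1 (mem_apery_of_mem_union hx)).2.1.1
  have hinj : ∀ x ∈ insert 0 (aperyPrimitives S ∪ aperyDecomposables S),
      ∀ y ∈ insert 0 (aperyPrimitives S ∪ aperyDecomposables S), x % m = y % m → x = y := by
    intro x hx y hy hxy
    rcases mem_insert.1 hx with rfl | hx <;> rcases mem_insert.1 hy with rfl | hy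
    · rfl
    · exact absurd (by simpa using hxy.symm) (h.mod_ne y hy)
    · exact absurd (by simpa using hxy) (h.mod_ne x hx)
    · exact h.mod_inj x hx y hy hxy
  have hcard : #((insert 0 (aperyPrimitives S ∪ aperyDecomposables S)).sigma
      fun x => range (tailCount c m x)) ≤ #(leftFinset S) := by
    refine card_le_card_of_injOn (fun y => y.1 + y.2 * m) (fun y hy => ?_)
      fun y hy z hz hyz => ?_
    · obtain ⟨h1, h2⟩ := mem_sigma.1 hy
      rw [mem_range, ← not_le, tailCount_le_iff hm, not_le] at h2
      exact mem_leftFinset.2 ⟨h2,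
        S.add_mem (hA _ h1) (by simpa using S.nsmul_mem hS.multiplicity_mem y.2)⟩
    · obtain ⟨h1, -⟩ := mem_sigma.1 hy
      obtain ⟨h2, -⟩ := mem_sigma.1 hz
      obtain ⟨y1, y2⟩ := y
      obtain ⟨z1, z2⟩ := z
      dsimp only at hyz h1 h2
      obtain rfl := hinj _ h1 _ h2 (by simpa using congrArg (· % m) hyz)
      have : y2 = z2 := Nat.eq_of_mul_eq_mul_right hm (by omega)
      rw [this]
  rw [card_sigma, sum_insert h0, sum_union h.disj] at hcard
  simp only [card_range] at hcard
  omega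

theorem mem_decomposablesAt_depth {x : ℕ} : x ∈ decomposablesAt S (depth S : ℤ) ↔
    x ∈ decomposables S ∧ conductor S ≤ x ∧ x < conductor S + multiplicity S := by
  have h : ((depth S : ℤ) + 1) * multiplicity S =
      depth S * multiplicity S + multiplicity S := by ring
  simp only [decomposablesAt, levelInterval, offset, Set.mem_ofPred_eq, Set.mem_Ico, h]
  refine and_congr_right fun _ => and_congr ?_ ?_ <;> omega

open Classical in
/-- The decomposable elements in `[c, c + m[` as a finset. -/
noncomputable def topDecomposables (S : AddSubmonoid ℕ) : Finset ℕ :=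
  {x ∈ Ico (conductor S) (conductor S + multiplicity S) | x ∈ decomposables S}

theorem mem_topDecomposables {x : ℕ} : x ∈ topDecomposables S ↔
    (conductor S ≤ x ∧ x < conductor S + multiplicity S) ∧ x ∈ decomposables S := by
  simp [topDecomposables]

theorem ncard_decomposablesAt_depth :
    (decomposablesAt S (depth S : ℤ)).ncard = #(topDecomposables S) := by
  rw [← Set.ncard_coe_finset]
  congr 1
  ext x
  rw [mem_decomposablesAt_depth, mem_coe, mem_topDecomposables, and_comm]

open Classical in
/-- The primitive elements below the conductor as a finset. -/
noncomputable def leftPrimitives (S : AddSubmonoid ℕ) : Finset ℕ :=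
  {x ∈ leftFinset S | x ∈ primitives S}

theorem mem_leftPrimitives {x : ℕ} :
    x ∈ leftPrimitives S ↔ (x < conductor S ∧ x ∈ S) ∧ x ∈ primitives S := by
  simp [leftPrimitives, mem_leftFinset]

theorem ncard_primitives_inter_leftPart :
    (primitives S ∩ leftPart S).ncard = #(leftPrimitives S) := by
  rw [← Set.ncard_coe_finset, ← coe_leftFinset]
  congr 1
  ext x
  simp [leftPrimitives, and_comm]

theorem W₀_eq (S : AddSubmonoid ℕ) : W₀ S = (#(leftPrimitives S) : ℤ) * #(leftFinset S) -
    depth S * #(topDecomposables S) + (depth S * multiplicity S - conductor S) := by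
  rw [W₀, ncard_primitives_inter_leftPart, ncard_leftPart, ncard_decomposablesAt_depth, offset]

theorem exists_apery_add (hS : IsNumericalSemigroup S) {x : ℕ} (hx : x ∈ S)
    (hxc : x < conductor S + multiplicity S) :
    ∃ u ∈ insert 0 (apery S), ∃ j : ℕ, x = u + j * multiplicity S := by
  induction x using Nat.strong_induction_on with
  | _ x ih =>
    by_cases hxA : x ∈ insert 0 (apery S)
    · exact ⟨x, hxA, 0, by simp⟩
    · have h1 : ∃ y ∈ S, x = y + multiplicity S := by
        by_contra h1
        refine hxA (mem_insert.2 (or_iff_not_imp_left.2 fun h0 => mem_apery.2 ⟨hxc, ⟨hx, h0⟩, h1⟩))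
      obtain ⟨y, hy, rfl⟩ := h1
      have hm := hS.multiplicity_pos
      obtain ⟨u, hu, j, rfl⟩ := ih y (by omega) hy (by omega)
      exact ⟨u, hu, j + 1, by ring⟩

/-- Every decomposable element in `[c, c + m[` is congruent modulo `m` to `0` or to an Apéry
element that is either below `c` or decomposable. -/
theorem card_topDecomposables_le (hS : IsNumericalSemigroup S) :
    #(topDecomposables S) ≤ 1 + (#(aperyPrimitives S) + #(aperyDecomposables S)) := by
  have h := aperySystem hS
  have hm := hS.multiplicity_pos
  have key : ∀ x ∈ topDecomposables S, ∃ u ∈ insert 0 (aperyPrimitives S ∪ aperyDecomposables S),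
      ∃ j : ℕ, x = u + j * multiplicity S := by
    intro x hx
    obtain ⟨hx1, hx2⟩ := mem_topDecomposables.1 hx
    obtain ⟨u, hu, j, rfl⟩ := exists_apery_add hS hx2.1.1 hx1.2
    refine ⟨u, ?_, j, rfl⟩
    rcases mem_insert.1 hu with rfl | hu
    · exact mem_insert_self _ _
    refine mem_insert_of_mem ?_
    rcases Nat.lt_or_ge u (conductor S) with huc | huc
    · exact mem_union_of_mem_apery hu huc
    · rcases Nat.eq_zero_or_pos j with rfl | hj
      · rw [zero_mul, add_zero] at hx2
        exact mem_union_right _ (mem_aperyDecomposables.2 ⟨hu, hx2⟩)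
      · have : 1 * multiplicity S ≤ j * multiplicity S := Nat.mul_le_mul_right _ hj
        omega
  choose! u hu j hj using key
  have h1 : #(topDecomposables S) ≤ #(insert 0 (aperyPrimitives S ∪ aperyDecomposables S)) := by
    refine card_le_card_of_injOn u hu fun x hx y hy hxy => ?_
    have hx1 := (mem_topDecomposables.1 hx).1
    have hy1 := (mem_topDecomposables.1 hy).1
    have hmod : x % multiplicity S = y % multiplicity S := by
      rw [hj x hx, hj y hy, hxy]
      simp
    rcases le_total x y with hle | hle
    · have := Nat.eq_zero_of_dvd_of_lt ((Nat.modEq_iff_dvd' hle).1 hmod) (by omega)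
      omega
    · have := Nat.eq_zero_of_dvd_of_lt ((Nat.modEq_iff_dvd' hle).1 hmod.symm) (by omega)
      omega
  have h2 := card_insert_le 0 (aperyPrimitives S ∪ aperyDecomposables S)
  have h3 := card_union_le (aperyPrimitives S) (aperyDecomposables S)
  omega

theorem multiplicity_mem_primitives (hS : IsNumericalSemigroup S) :
    multiplicity S ∈ primitives S := by
  refine ⟨hS.multiplicity_mem_star, fun ⟨a, ha, b, hb, h⟩ => ?_⟩
  have h1 := multiplicity_le ha
  have h2 := multiplicity_le hb
  have := hS.multiplicity_pos
  omega

/-- If `c ≤ m` there are no decomposable elements below `c + m`. Otherwise `AperySystem.bound`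
applies. -/
theorem W₀_nonneg (hS : IsNumericalSemigroup S) (hL : (leftPart S).ncard ≤ 12) : 0 ≤ W₀ S := by
  have h := aperySystem hS
  have hq := hS.conductor_le_depth_mul
  rw [W₀_eq]
  rcases Nat.lt_or_ge (multiplicity S) (conductor S) with hmc | hmc
  · rw [ncard_leftPart] at hL
    have hw := depth_add_weight_le hS
    have hb := h.bound (hw.trans hL)
    have hD := card_topDecomposables_le hS
    have hP : #(aperyPrimitives S) + 1 ≤ #(leftPrimitives S) := by
      have hnot : multiplicity S ∉ aperyPrimitives S := fun hm => (h.lt_of_mem _ hm).ne rfl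
      rw [← card_insert_of_notMem hnot]
      refine card_le_card (insert_subset ?_ fun x hx => ?_)
      · exact mem_leftPrimitives.2 ⟨⟨hmc, hS.multiplicity_mem⟩,
          multiplicity_mem_primitives hS⟩
      · obtain ⟨-, hx1, hx2⟩ := mem_aperyPrimitives.1 hx
        exact mem_leftPrimitives.2 ⟨⟨hx2, hx1.1.1⟩, hx1⟩
    generalize ∑ x ∈ aperyPrimitives S, tailCount (conductor S) (multiplicity S) x +
      ∑ x ∈ aperyDecomposables S, tailCount (conductor S) (multiplicity S) x = w at hw hb
    have h1 := Nat.mul_le_mul hP hw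
    have h2 := Nat.mul_le_mul_left (depth S) hD
    have h3 : depth S * #(topDecomposables S) ≤ #(leftPrimitives S) * #(leftFinset S) +
        (depth S * multiplicity S - conductor S) := by
      calc depth S * #(topDecomposables S)
          ≤ depth S * (1 + #(aperyPrimitives S)) + depth S * #(aperyDecomposables S) := by
            rw [← mul_add, add_assoc]; exact h2
        _ ≤ depth S * (1 + #(aperyPrimitives S)) + ((#(aperyPrimitives S) + 1) * w +
            (depth S * multiplicity S - conductor S)) := Nat.add_le_add_left hb _
        _ = (#(aperyPrimitives S) + 1) * (depth S + w) +
            (depth S * multiplicity S - conductor S) := by ring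
        _ ≤ _ := Nat.add_le_add_right h1 _
    zify [hq] at h3
    linarith
  · have hD : #(topDecomposables S) = 0 := by
      rw [card_eq_zero]
      refine eq_empty_of_forall_notMem fun x hx => ?_
      obtain ⟨hx1, hx2⟩ := mem_topDecomposables.1 hx
      obtain ⟨a, ha, b, hb, rfl⟩ := mem_decomposables.1 hx2
      have h1 := multiplicity_le ha
      have h2 := multiplicity_le hb
      omega
    rw [hD]
    zify at hq
    have : (0 : ℤ) ≤ #(leftPrimitives S) * #(leftFinset S) := by positivity
    push_cast
    linarith

/-- Every generating set contains all primitive elements. -/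
theorem primitives_subset_of_closure_eq {T : Set ℕ} (hT : AddSubmonoid.closure T = S) :
    primitives S ⊆ T := by
  have key : ∀ x ∈ AddSubmonoid.closure T, x = 0 ∨ x ∈ T ∨ x ∈ decomposables S := by
    intro x hx
    induction hx using AddSubmonoid.closure_induction with
    | mem x hx => exact Or.inr (Or.inl hx)
    | zero => exact Or.inl rfl
    | add x y hx hy ihx ihy =>
      rcases Nat.eq_zero_or_pos x with rfl | hx0
      · simpa using ihy
      rcases Nat.eq_zero_or_pos y with rfl | hy0
      · simpa using ihx
      rw [hT] at hx hy
      exact Or.inr (Or.inr (mem_decomposables.2 ⟨x, ⟨hx, hx0.ne'⟩, y, ⟨hy, hy0.ne'⟩, rfl⟩))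
  intro x hx
  rcases key x (hT ▸ hx.1.1) with h | h | h
  · exact absurd h hx.1.2
  · exact h
  · exact absurd hx h.2

open Classical in
theorem exists_closure_eq (hS : IsNumericalSemigroup S) :
    ∃ T : Finset ℕ, #T = embDim S ∧ AddSubmonoid.closure (T : Set ℕ) = S := by
  refine Nat.sInf_mem (s := {n | ∃ T : Finset ℕ, #T = n ∧ AddSubmonoid.closure (T : Set ℕ) = S})
    ⟨_, {x ∈ range (conductor S + multiplicity S + 1) | x ∈ S}, rfl, ?_⟩
  refine le_antisymm ((AddSubmonoid.closure_le).2 fun x hx => (mem_filter.1 hx).2) fun x hx => ?_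
  have hm := hS.multiplicity_pos
  induction x using Nat.strong_induction_on with
  | _ x ih =>
    rcases Nat.lt_or_ge x (conductor S + multiplicity S + 1) with hlt | hge
    · exact AddSubmonoid.subset_closure (mem_filter.2 ⟨mem_range.2 hlt, hx⟩)
    · rw [show x = x - multiplicity S + multiplicity S by omega]
      exact add_mem (ih _ (by omega) (hS.conductor_spec (by omega)))
        (ih _ (by omega) hS.multiplicity_mem)

/-- A generating set contains the primitive elements below `c` and those in `[c, c + m[`, of which
there are `m` minus the number of decomposable elements there. -/
theorem card_leftPrimitives_add_multiplicity_le (hS : IsNumericalSemigroup S)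
    (hc : 0 < conductor S) :
    #(leftPrimitives S) + multiplicity S ≤ embDim S + #(topDecomposables S) := by
  classical
  obtain ⟨T, hT, hTS⟩ := exists_closure_eq hS
  have hsub := primitives_subset_of_closure_eq hTS
  have h1 : leftPrimitives S ∪
      {x ∈ Ico (conductor S) (conductor S + multiplicity S) | x ∉ decomposables S} ⊆ T := by
    intro x hx
    rcases mem_union.1 hx with hx | hx
    · exact hsub (mem_leftPrimitives.1 hx).2
    · obtain ⟨h2, h3⟩ := mem_filter.1 hx
      rw [mem_Ico] at h2
      have h4 : x ∈ star S := ⟨hS.conductor_spec h2.1, fun h0 => by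
        rw [Set.mem_singleton_iff] at h0; omega⟩
      by_contra hxT
      exact h3 ⟨h4, fun hp => hxT (hsub hp)⟩
  have hdisj : Disjoint (leftPrimitives S)
      {x ∈ Ico (conductor S) (conductor S + multiplicity S) | x ∉ decomposables S} := by
    refine disjoint_left.2 fun x hx hx' => ?_
    have h2 := (mem_leftPrimitives.1 hx).1.1
    have h3 := mem_Ico.1 (mem_filter.1 hx').1
    omega
  have h2 := card_le_card h1
  rw [card_union_of_disjoint hdisj] at h2
  have h3 := card_filter_add_card_filter_not (s := Ico (conductor S) (conductor S + multiplicity S))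
    (· ∈ decomposables S)
  rw [Nat.card_Ico] at h3
  rw [topDecomposables]
  omega

theorem depth_le_card_leftFinset (hS : IsNumericalSemigroup S) : depth S ≤ #(leftFinset S) :=
  (Nat.le_add_right _ _).trans (depth_add_weight_le hS)

theorem W₀_le_W (hS : IsNumericalSemigroup S) : W₀ S ≤ W S := by
  rw [W₀_eq, W, ncard_leftPart]
  rcases Nat.eq_zero_or_pos (conductor S) with hc | hc
  · have hL : leftFinset S = ∅ := by simp [leftFinset, hc]
    have hq : depth S = 0 := by simp [depth, hc]
    simp [hL, hq, hc]
  · have h1 := card_leftPrimitives_add_multiplicity_le hS hc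
    have h2 := depth_le_card_leftFinset hS
    have h3 : #(topDecomposables S) ≤ multiplicity S := by
      classical
      simpa [topDecomposables] using
        card_filter_le (Ico (conductor S) (conductor S + multiplicity S)) _
    zify at h1 h2 h3
    nlinarith [mul_le_mul_of_nonneg_right h1 (Int.natCast_nonneg #(leftFinset S)),
      mul_nonneg (sub_nonneg.2 h2) (sub_nonneg.2 h3)]

theorem satisfiesWilf_of_W₀_nonneg (hS : IsNumericalSemigroup S) (h : 0 ≤ W₀ S) :
    SatisfiesWilf S := by
  have h1 := h.trans (W₀_le_W hS)
  rw [W, sub_nonneg] at h1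
  exact_mod_cast h1

/-! ### The semigroup generated by 14, 22, 23 and all integers from 56 on -/

/-- The nonzero elements below `56` of the semigroup generated by `14`, `22` and `23`. -/
def smallElements : Finset ℕ := {14, 22, 23, 28, 36, 37, 42, 44, 45, 46, 50, 51}

/-- The numerical semigroup `⟨14, 22, 23⟩ ∪ [56, ∞[`. -/
def extremalSemigroup : AddSubmonoid ℕ where
  carrier := {x | x = 0 ∨ x ∈ smallElements ∨ 56 ≤ x}
  zero_mem' := Or.inl rfl
  add_mem' := by
    have key : ∀ a ∈ smallElements, ∀ b ∈ smallElements,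
        a + b ∈ smallElements ∨ 56 ≤ a + b := by decide
    rintro a b (rfl | ha | ha) hb
    · simpa using hb
    · rcases hb with rfl | hb | hb
      · exact Or.inr (Or.inl ha)
      · exact Or.inr (key a ha b hb)
      · exact Or.inr (Or.inr (by omega))
    · exact Or.inr (Or.inr (by omega))

theorem mem_extremalSemigroup {x : ℕ} :
    x ∈ extremalSemigroup ↔ x = 0 ∨ x ∈ smallElements ∨ 56 ≤ x := Iff.rfl

theorem coe_extremalSemigroup : (extremalSemigroup : Set ℕ) =
    (AddSubmonoid.closure ({14, 22, 23} : Set ℕ) : Set ℕ) ∪ Set.Ici 56 := by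
  ext x
  constructor
  · rintro (rfl | hx | hx)
    · exact Or.inl (zero_mem _)
    · left
      have h14 : 14 ∈ AddSubmonoid.closure ({14, 22, 23} : Set ℕ) :=
        AddSubmonoid.subset_closure (by simp)
      have h22 : 22 ∈ AddSubmonoid.closure ({14, 22, 23} : Set ℕ) :=
        AddSubmonoid.subset_closure (by simp)
      have h23 : 23 ∈ AddSubmonoid.closure ({14, 22, 23} : Set ℕ) :=
        AddSubmonoid.subset_closure (by simp)
      simp only [smallElements, mem_insert, mem_singleton] at hx
      rcases hx with rfl | rfl | rfl | rfl | rfl | rfl | rfl | rfl | rfl | rfl | rfl | rfl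
      · exact h14
      · exact h22
      · exact h23
      · exact add_mem h14 h14
      · exact add_mem h14 h22
      · exact add_mem h14 h23
      · exact add_mem (add_mem h14 h14) h14
      · exact add_mem h22 h22
      · exact add_mem h22 h23
      · exact add_mem h23 h23
      · exact add_mem (add_mem h14 h14) h22
      · exact add_mem (add_mem h14 h14) h23
    · exact Or.inr hx
  · rintro (hx | hx)
    · refine (AddSubmonoid.closure_le (S := extremalSemigroup)).2 ?_ hx
      rintro y (rfl | rfl | rfl) <;> exact Or.inr (Or.inl (by decide))
    · exact Or.inr (Or.inr hx)

theorem isNumericalSemigroup_extremalSemigroup : IsNumericalSemigroup extremalSemigroup :=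
  (Set.finite_Iio 56).subset fun x hx => by
    by_contra h
    exact hx (Or.inr (Or.inr (not_lt.1 h)))

theorem conductor_extremalSemigroup : conductor extremalSemigroup = 56 := by
  refine le_antisymm (Nat.sInf_le fun x hx => Or.inr (Or.inr hx)) ?_
  by_contra! h
  have h55 := isNumericalSemigroup_extremalSemigroup.conductor_spec (n := 55) (by omega)
  rw [mem_extremalSemigroup] at h55
  revert h55
  decide

theorem multiplicity_extremalSemigroup : multiplicity extremalSemigroup = 14 := by
  refine le_antisymm (multiplicity_le ⟨Or.inr (Or.inl (by decide)), by simp⟩) ?_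
  obtain ⟨h1, h2⟩ := isNumericalSemigroup_extremalSemigroup.multiplicity_mem_star
  have h3 : ∀ x ∈ smallElements, 14 ≤ x := by decide
  rcases h1 with h1 | h1 | h1
  · exact absurd h1 h2
  · exact h3 _ h1
  · omega

theorem depth_extremalSemigroup : depth extremalSemigroup = 4 := by
  rw [depth, conductor_extremalSemigroup, multiplicity_extremalSemigroup]
  norm_num

theorem leftFinset_extremalSemigroup : leftFinset extremalSemigroup = insert 0 smallElements := by
  have h : ∀ x ∈ smallElements, x < 56 := by decide
  ext x
  rw [mem_leftFinset, conductor_extremalSemigroup, mem_extremalSemigroup, mem_insert]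
  have := h x
  grind

/-- Below `c + m`, only the nonzero elements of the left part occur as summands. -/
theorem mem_decomposables_extremalSemigroup {x : ℕ} (hx : x < 70) :
    x ∈ decomposables extremalSemigroup ↔
      ∃ a ∈ smallElements, ∃ b ∈ smallElements, x = a + b := by
  have hpos : ∀ a ∈ smallElements, a ≠ 0 := by decide
  rw [mem_decomposables]
  constructor
  · rintro ⟨a, ha, b, hb, rfl⟩
    have h1 := multiplicity_le ha
    have h2 := multiplicity_le hb
    rw [multiplicity_extremalSemigroup] at h1 h2
    refine ⟨a, ?_, b, ?_, rfl⟩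
    · rcases ha.1 with h | h | h
      · omega
      · exact h
      · omega
    · rcases hb.1 with h | h | h
      · omega
      · exact h
      · omega
  · rintro ⟨a, ha, b, hb, rfl⟩
    exact ⟨a, ⟨Or.inr (Or.inl ha), hpos a ha⟩, b, ⟨Or.inr (Or.inl hb), hpos b hb⟩, rfl⟩

theorem leftPrimitives_extremalSemigroup : leftPrimitives extremalSemigroup = {14, 22, 23} := by
  have h : ({14, 22, 23} : Finset ℕ) =
      {x ∈ smallElements | ¬ ∃ a ∈ smallElements, ∃ b ∈ smallElements, x = a + b} := by decide
  have hlt : ∀ x ∈ smallElements, x < 56 ∧ x ≠ 0 := by decide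
  ext x
  rw [h, mem_leftPrimitives, conductor_extremalSemigroup, mem_filter, mem_extremalSemigroup]
  constructor
  · rintro ⟨⟨hx, hxS⟩, hp⟩
    rw [← mem_decomposables_extremalSemigroup (by omega)]
    refine ⟨?_, fun hd => hd.2 hp⟩
    rcases hxS with rfl | hxS | hxS
    · exact absurd rfl hp.1.2
    · exact hxS
    · omega
  · rintro ⟨hx, hd⟩
    obtain ⟨hx1, hx2⟩ := hlt x hx
    rw [← mem_decomposables_extremalSemigroup (by omega)] at hd
    refine ⟨⟨hx1, Or.inr (Or.inl hx)⟩, ?_⟩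
    by_contra hp
    exact hd ⟨⟨Or.inr (Or.inl hx), hx2⟩, hp⟩

theorem card_topDecomposables_extremalSemigroup :
    #(topDecomposables extremalSemigroup) = 10 := by
  have h : topDecomposables extremalSemigroup =
      {x ∈ Ico 56 70 | ∃ a ∈ smallElements, ∃ b ∈ smallElements, x = a + b} := by
    ext x
    rw [mem_topDecomposables, conductor_extremalSemigroup, multiplicity_extremalSemigroup,
      mem_filter, mem_Ico]
    exact and_congr_right fun hx => mem_decomposables_extremalSemigroup hx.2
  rw [h]
  decide

theorem W₀_extremalSemigroup : W₀ extremalSemigroup = -1 := by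
  rw [W₀_eq, leftPrimitives_extremalSemigroup, leftFinset_extremalSemigroup,
    card_topDecomposables_extremalSemigroup, depth_extremalSemigroup,
    conductor_extremalSemigroup, multiplicity_extremalSemigroup]
  decide

end NumSemigroup

theorem mainTheorem1 :
    (∀ S : AddSubmonoid ℕ, NumSemigroup.IsNumericalSemigroup S →
      (NumSemigroup.leftPart S).ncard ≤ 12 →
        0 ≤ NumSemigroup.W₀ S ∧ NumSemigroup.SatisfiesWilf S) ∧
    (∀ S : AddSubmonoid ℕ, NumSemigroup.IsNumericalSemigroup S →
      NumSemigroup.W₀ S ≤ NumSemigroup.W S) ∧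
    (∃ S : AddSubmonoid ℕ, NumSemigroup.IsNumericalSemigroup S ∧
      (S : Set ℕ) = (AddSubmonoid.closure ({14, 22, 23} : Set ℕ) : Set ℕ) ∪ Set.Ici 56 ∧
      (NumSemigroup.leftPart S).ncard = 13 ∧ NumSemigroup.W₀ S = -1) := by
  refine ⟨fun S hS hL => ?_, fun S hS => NumSemigroup.W₀_le_W hS,
    NumSemigroup.extremalSemigroup, NumSemigroup.isNumericalSemigroup_extremalSemigroup,
    NumSemigroup.coe_extremalSemigroup, ?_, NumSemigroup.W₀_extremalSemigroup⟩
  · have h := NumSemigroup.W₀_nonneg hS hL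
    exact ⟨h, NumSemigroup.satisfiesWilf_of_W₀_nonneg hS h⟩
  · rw [NumSemigroup.ncard_leftPart, NumSemigroup.leftFinset_extremalSemigroup]
    decide
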